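/- For a finite alphabet $A$, let $A^*$ be the free monoid on $A$, let $|w|$ be the length of a word $w$, let $T$ be the shift $T((x_n)_{n\in\mathbb Z})=(x_{n+1})_{n\in\mathbb Z}$ on $A^{\mathbb Z}$, and call $x\in A^{\mathbb Z}$ periodic if $T^n(x)=x$ for some $n\ge 1$, aperiodic otherwise. A morphism $\tau\colon A^*\to B^*$ (possibly erasing, i.e., mapping letters to the empty word) is extended by $\tau(x)=\cdots\tau(x_{-2})\tau(x_{-1})\cdot\tau(x_0)\tau(x_1)\cdots$ to those points $x\in A^{\mathbb Z}$ that have infinitely many non-erased letters on the left and on the right. A $\tau$-representation of $y\in B^{\mathbb Z}$ in $X\subseteq A^{\mathbb Z}$ is a pair $(x,k)$ with $x\in X$ in this domain, $k\in\mathbb Z$ and $y=T^k(\tau(x))$; it is centered if $0\le k<|\tau(x_0)|$. Let $\sigma=(\sigma_n)_{n\ge 0}$ be a sequence of (possibly erasing) morphisms $\sigma_n\colon A_{n+1}^*\to A_n^*$ with finite alphabets $A_n$. For $n\le m$ put $\sigma_{[n,m)}=\sigma_n\circ\sigma_{n+1}\circ\cdots\circ\sigma_{m-1}$, with $\sigma_{[n,n)}$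 the identity. Let $\mathcal L^{(n)}(\sigma)\subseteq A_n^*$ be the set of factors of the words $\sigma_{[n,m)}(a)$, $m\ge n$, $a\in A_m$, and let $X^{(n)}(\sigma)\subseteq A_n^{\mathbb Z}$ be the set of points all of whose factors lie in $\mathcal L^{(n)}(\sigma)$. The sequence $\sigma$ is recognizable at level $n$ for aperiodic points if every aperiodic point of $A_n^{\mathbb Z}$ has at most one centered $\sigma_n$-representation in $X^{(n+1)}(\sigma)$; it is representable at level $n$ if every point of $X^{(n)}(\sigma)$ has at least one $\sigma_n$-representation in $X^{(n+1)}(\sigma)$. It is eventually recognizable for aperiodic points (respectively eventually representable) if there is an $M$ such that it has the respective property at each level $n\ge M$. Theorem. Suppose that the alphabet rank $r=\liminf_{n\to\infty}\operatorname{Card}(A_n)$ is finite. Then $\sigma$ is eventually recognizable for aperiodic points and eventually representable. Moreover, the number of levels $n\ge 0$ at which $\sigma$ is not recognizable for aperiodic points is at most $\max(r-2,0)$, and the number of levels $n\ge 0$ at which $\sigma$ is not representable is at most $\max(r-1,0)$. -/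

import Mathlib

open Filter

namespace SAdic

section Points

variable {A B : Type*}

/-- The `k`-th power `T ^ k` (with `k` an integer) of the shift transformation on two-sided
sequences: `(T ^ k x)_n = x_{n + k}`. -/
def shift (k : ℤ) (x : ℤ → A) : ℤ → A := fun n => x (n + k)

/-- A point is periodic if `T ^ n x = x` for some integer `n ≥ 1`. -/
def IsPeriodic (x : ℤ → A) : Prop := ∃ n : ℕ, 1 ≤ n ∧ shift (n : ℤ) x = x

/-- The word `x_{[i,j)} = x_i x_{i+1} ⋯ x_{j-1}`, for `i ≤ j`. -/
def word (x : ℤ → A) (i j : ℤ) : FreeMonoid A :=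
  FreeMonoid.ofList ((List.range (j - i).toNat).map fun k : ℕ => x (i + (k : ℤ)))

/-- `u` is a factor of `w`: there are words `r`, `t` with `w = r u t`. -/
def IsFactor (u w : FreeMonoid A) : Prop := ∃ r t : FreeMonoid A, w = r * u * t

/-- The position in `σ(x)` at which the block `σ(x_n)` starts: it is `|σ(x_{[0,n)})|` for `n ≥ 0`
and `-|σ(x_{[n,0)})|` for `n < 0` (one of the two sums below is always empty). -/
noncomputable def blockStart (σ : FreeMonoid A →* FreeMonoid B) (x : ℤ → A) (n : ℤ) : ℤ :=
  ∑ i ∈ Finset.Ico 0 n, ((σ (FreeMonoid.of (x i))).length : ℤ)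
    - ∑ i ∈ Finset.Ico n 0, ((σ (FreeMonoid.of (x i))).length : ℤ)

/-- The domain of the extension of `σ` to two-sided sequences: infinitely many letters of `x` on
the left, and infinitely many on the right, are not erased by `σ`. -/
def InDomain (σ : FreeMonoid A →* FreeMonoid B) (x : ℤ → A) : Prop :=
  (∀ N : ℤ, ∃ i : ℤ, i ≤ N ∧ σ (FreeMonoid.of (x i)) ≠ 1) ∧
    (∀ N : ℤ, ∃ i : ℤ, N ≤ i ∧ σ (FreeMonoid.of (x i)) ≠ 1)

/-- `σ(x)` is defined and equal to `y`: the point `x` is in the domain of `σ`, and for every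
`n` the block of `y` between the positions `blockStart σ x n` (included) and
`blockStart σ x (n + 1)` (excluded) is the word `σ(x_n)`. -/
def IsImage (σ : FreeMonoid A →* FreeMonoid B) (x : ℤ → A) (y : ℤ → B) : Prop :=
  InDomain σ x ∧
    ∀ n : ℤ, word y (blockStart σ x n) (blockStart σ x (n + 1)) = σ (FreeMonoid.of (x n))

/-- `(x, k)` is a `σ`-representation of `y`, that is, `y = T ^ k (σ(x))`. -/
def IsRepresentation (σ : FreeMonoid A →* FreeMonoid B) (y : ℤ → B) (x : ℤ → A) (k : ℤ) : Prop :=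
  ∃ z : ℤ → B, IsImage σ x z ∧ y = shift k z

/-- `(x, k)` is a centered `σ`-representation of `y`: moreover `0 ≤ k < |σ(x_0)|`. -/
def IsCenteredRepresentation (σ : FreeMonoid A →* FreeMonoid B) (y : ℤ → B)
    (x : ℤ → A) (k : ℤ) : Prop :=
  IsRepresentation σ y x k ∧ 0 ≤ k ∧ k < ((σ (FreeMonoid.of (x 0))).length : ℤ)

/-- `σ` is recognizable in `X` for aperiodic points: every aperiodic point has at most one centered
`σ`-representation `(x, k)` with `x ∈ X`. -/
def RecognizableForAperiodic (σ : FreeMonoid A →* FreeMonoid B) (X : Set (ℤ → A)) : Prop :=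
  ∀ y : ℤ → B, ¬ IsPeriodic y →
    ∀ x ∈ X, ∀ x' ∈ X, ∀ k k' : ℤ,
      IsCenteredRepresentation σ y x k → IsCenteredRepresentation σ y x' k' → x = x' ∧ k = k'

end Points

section Sequences

variable {A : ℕ → Type*}

/-- The composition `σ_{[n, n+k)} = σ_n ∘ σ_{n+1} ∘ ⋯ ∘ σ_{n+k-1}`. -/
def comp (σ : ∀ n, FreeMonoid (A (n + 1)) →* FreeMonoid (A n)) (n : ℕ) :
    ∀ k : ℕ, FreeMonoid (A (n + k)) →* FreeMonoid (A n)
  | 0 => MonoidHom.id (FreeMonoid (A n))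
  | k + 1 => (comp σ n k).comp (σ (n + k))

/-- The language of level `n`: all factors of the words `σ_{[n,m)}(a)`, `m ≥ n`, `a ∈ A_m`
(with `m = n + k`). -/
def language (σ : ∀ n, FreeMonoid (A (n + 1)) →* FreeMonoid (A n)) (n : ℕ) :
    Set (FreeMonoid (A n)) :=
  {w | ∃ (k : ℕ) (a : A (n + k)), IsFactor w (comp σ n k (FreeMonoid.of a))}

/-- The shift space of level `n`: all points whose factors all lie in the language of level `n`. -/
def shiftSpace (σ : ∀ n, FreeMonoid (A (n + 1)) →* FreeMonoid (A n)) (n : ℕ) :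
    Set (ℤ → A n) :=
  {x | ∀ i j : ℤ, i ≤ j → word x i j ∈ language σ n}

/-- The sequence `σ` is recognizable at level `n` for aperiodic points. -/
def RecognizableForAperiodicAt (σ : ∀ n, FreeMonoid (A (n + 1)) →* FreeMonoid (A n)) (n : ℕ) :
    Prop :=
  RecognizableForAperiodic (σ n) (shiftSpace σ (n + 1))

/-- The sequence `σ` is representable at level `n`: every point of the shift space of level `n`
has a `σ_n`-representation in the shift space of level `n + 1`. -/
def RepresentableAt (σ : ∀ n, FreeMonoid (A (n + 1)) →* FreeMonoid (A n)) (n : ℕ) : Prop :=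
  ∀ y ∈ shiftSpace σ n, ∃ x ∈ shiftSpace σ (n + 1), ∃ k : ℤ, IsRepresentation (σ n) y x k

/-- The sequence `σ` is eventually recognizable for aperiodic points. -/
def EventuallyRecognizableForAperiodic
    (σ : ∀ n, FreeMonoid (A (n + 1)) →* FreeMonoid (A n)) : Prop :=
  ∃ M : ℕ, ∀ n ≥ M, RecognizableForAperiodicAt σ n

/-- The sequence `σ` is eventually representable. -/
def EventuallyRepresentable (σ : ∀ n, FreeMonoid (A (n + 1)) →* FreeMonoid (A n)) : Prop :=
  ∃ M : ℕ, ∀ n ≥ M, RepresentableAt σ n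

end Sequences

/-- The alphabet rank `liminf Card(A_n)`, in `{0, 1, 2, …, ∞}`. -/
noncomputable def alphabetRank (A : ℕ → Type*) : ℕ∞ :=
  liminf (fun n => ENat.card (A n)) atTop

end SAdic

/-! Call the rank of a morphism φ the least number k of letters such that φ factors through a free
monoid on k letters, and call φ elementary if it does not factor through fewer letters than its
alphabet has. Fix m with Card(A_m) ≤ r; such m are arbitrarily large. The map i ↦ rank σ_[i,m) is
nondecreasing and at most r at i = m. The properties fail only where it jumps, so failures are
counted by the values available.

Write σ_[i+1,m) = α ∘ β through rank-many letters. If the rank does not jump at i, then σ_i ∘ α is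
elementary, as otherwise σ_[i,m) = (σ_i ∘ α) ∘ β would have smaller rank. By compactness, points of
X^(i+1) have α-representations and points of X^(i) have (σ_i ∘ α)-representations. Uniqueness of the
latter for aperiodic points gives recognizability at level i (`recognizableForAperiodicAt_of_rank`);
applying α to them gives representability (`representableAt_of_rank`).

The core is that an elementary morphism is recognizable for aperiodic points
(`IsTiling.eq_of_not_isPeriodic`). By a defect theorem, a right-infinite decomposition into the
words φ(a) is determined by its starting position (`eq_of_decomposable`), so two tilings of y with a
common cut agree to its right. Without a common cut, a block starting inside a block of the other
tiling is determined by the remaining part of that block (`eq_of_decomposable_of_overhang`). The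
pair of tilings is then deterministic with finitely many states, so it is periodic, and y with it.

A jump to rank at most 2 does not harm recognizability: σ_i ∘ α is elementary or has only periodic
images. A jump from rank 0 does not harm representability: X^(i) is empty. Harmful jumps thus end at
distinct values in [3, r], respectively [2, r]. -/

namespace SAdic

/-! ### Decompositions of right-infinite words and the defect theorem -/

section Defect

variable {C : Type*}

/-- The word `w` occurs in `y` at position `p`. -/
def Occurs (y : ℤ → C) (p : ℤ) (w : List C) : Prop :=
  ∀ j : ℕ, ∀ h : j < w.length, y (p + j) = w[j]

theorem occurs_append {y : ℤ → C} {p : ℤ} {u v : List C} :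
    Occurs y p (u ++ v) ↔ Occurs y p u ∧ Occurs y (p + u.length) v := by
  constructor
  · intro h
    refine ⟨fun j hj => ?_, fun j hj => ?_⟩
    · rw [h j (by simp; omega), List.getElem_append_left hj]
    · have := h (u.length + j) (by simp; omega)
      rw [List.getElem_append_right (by omega)] at this
      push_cast at this
      rw [← add_assoc] at this
      simpa using this
  · rintro ⟨h1, h2⟩ j hj
    by_cases hju : j < u.length
    · rw [h1 j hju, List.getElem_append_left hju]
    · rw [List.getElem_append_right (by omega)]
      rw [← h2 (j - u.length) (by simp at hj; omega)]
      congr 1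
      omega

theorem occurs_nil (y : ℤ → C) (p : ℤ) : Occurs y p [] := fun j h => by simp at h

/-- The positions of `y` from which on `y` is an infinite product of words `f d`. -/
def Decomposable {D : Type*} (y : ℤ → C) (f : D → List C) : Set ℤ :=
  {p | ∃ S : Set ℤ, p ∈ S ∧ ∀ q ∈ S, ∃ d, Occurs y q (f d) ∧ q + (f d).length ∈ S}

theorem Decomposable.exists_step {D : Type*} {y : ℤ → C} {f : D → List C} {p : ℤ}
    (h : p ∈ Decomposable y f) :
    ∃ d, Occurs y p (f d) ∧ p + (f d).length ∈ Decomposable y f := by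
  obtain ⟨S, hp, hS⟩ := h
  obtain ⟨d, hd, hd'⟩ := hS p hp
  exact ⟨d, hd, S, hd', hS⟩

theorem Decomposable.cons {D : Type*} {y : ℤ → C} {f : D → List C} {p : ℤ} {d : D}
    (h : Occurs y p (f d)) (h' : p + (f d).length ∈ Decomposable y f) :
    p ∈ Decomposable y f := by
  refine ⟨insert p (Decomposable y f), Set.mem_insert _ _, ?_⟩
  rintro q (rfl | hq)
  · exact ⟨d, h, Set.mem_insert_of_mem _ h'⟩
  · obtain ⟨d, hd, hd'⟩ := Decomposable.exists_step hq
    exact ⟨d, hd, Set.mem_insert_of_mem _ hd'⟩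

theorem Decomposable.append {B : Type*} {y : ℤ → C} {α : B → List C} {w : List B} {p : ℤ}
    (h : Occurs y p (w.flatMap α)) (h' : p + (w.flatMap α).length ∈ Decomposable y α) :
    p ∈ Decomposable y α := by
  induction w generalizing p with
  | nil => simpa using h'
  | cons b w ih =>
    rw [List.flatMap_cons, occurs_append] at h
    refine Decomposable.cons h.1 (ih h.2 ?_)
    rw [List.flatMap_cons, List.length_append] at h'
    push_cast at h'
    rwa [← add_assoc] at h'

/-- A decomposition into words that are themselves nonempty products can be refined. -/
theorem Decomposable.refine {B D : Type*} {y : ℤ → C} {α : B → List C} {β : D → List B}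
    (hβ : ∀ d, β d ≠ []) {p : ℤ} (h : p ∈ Decomposable y fun d => (β d).flatMap α) :
    p ∈ Decomposable y α := by
  -- The witness consists of the positions reached in the middle of a block, with `w` the letters of
  -- that block still to be read.
  refine ⟨{q | ∃ w : List B, Occurs y q (w.flatMap α) ∧
    q + (w.flatMap α).length ∈ Decomposable y fun d => (β d).flatMap α},
    ⟨[], occurs_nil _ _, by simpa using h⟩, ?_⟩
  have key : ∀ (q : ℤ) (b : B) (w : List B), Occurs y q ((b :: w).flatMap α) →
      q + ((b :: w).flatMap α).length ∈ (Decomposable y fun d => (β d).flatMap α) →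
      Occurs y q (α b) ∧ ∃ w : List B, Occurs y (q + (α b).length) (w.flatMap α) ∧
        q + (α b).length + (w.flatMap α).length ∈ Decomposable y fun d => (β d).flatMap α := by
    intro q b w h1 h2
    rw [List.flatMap_cons, occurs_append] at h1
    refine ⟨h1.1, w, h1.2, ?_⟩
    rw [List.flatMap_cons, List.length_append] at h2
    push_cast at h2
    rwa [← add_assoc] at h2
  rintro q ⟨w, hw, hw'⟩
  rcases w with _ | ⟨b, w⟩
  · have hq : q ∈ Decomposable y fun d => (β d).flatMap α := by simpa using hw'
    obtain ⟨d, hd, hd'⟩ := Decomposable.exists_step hq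
    obtain ⟨b, w, hbw⟩ := List.exists_cons_of_ne_nil (hβ d)
    simp only [hbw] at hd hd'
    exact ⟨b, key q b w hd hd'⟩
  · exact ⟨b, key q b w hw hw'⟩

/-- A right-infinite decomposition of `y` into words `α b` is determined by its initial position:
its first letter is. -/
def UniquelyDecomposable {B : Type*} (y : ℤ → C) (α : B → List C) : Prop :=
  ∀ (p : ℤ) (b b' : B), Occurs y p (α b) → p + (α b).length ∈ Decomposable y α →
    Occurs y p (α b') → p + (α b').length ∈ Decomposable y α → b = b'

/-- A word that does not begin with `b` is a product of words `z b ^ i` with `z ≠ b`. -/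
theorem exists_blocks {B : Type*} [DecidableEq B] (b : B) (w : List B) :
    ∃ (i : ℕ) (w' : List ({z : B // z ≠ b} × ℕ)),
      w = List.replicate i b ++ w'.flatMap (fun q => (q.1 : B) :: List.replicate q.2 b) ∧
      w'.length = w.countP (fun c => c ≠ b) := by
  induction w with
  | nil => exact ⟨0, [], by simp⟩
  | cons c w ih =>
    obtain ⟨i, w', h1, h2⟩ := ih
    by_cases hc : c = b
    · refine ⟨i + 1, w', ?_, ?_⟩
      · rw [List.replicate_succ, List.cons_append, ← h1, hc]
      · rw [List.countP_cons_of_neg (by simp [hc]), h2]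
    · refine ⟨0, (⟨c, hc⟩, i) :: w', ?_, ?_⟩
      · simp only [List.replicate_zero, List.nil_append, List.flatMap_cons, List.cons_append]
        rw [← h1]
      · rw [List.countP_cons_of_pos (by simp [hc]), List.length_cons, h2]

/-- The first letter `z` is determined by `hα`. If two exponents i < j were possible, then after z
b^i one decomposition would continue with a letter other than `b` and the other with `b`, against
`hα`. -/
theorem UniquelyDecomposable.blocks {B : Type*} {y : ℤ → C} {α : B → List C}
    (hα : UniquelyDecomposable y α) (b : B) :
    UniquelyDecomposable y fun q : {z : B // z ≠ b} × ℕ =>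
      ((q.1 : B) :: List.replicate q.2 b).flatMap α := by
  set α' : {z : B // z ≠ b} × ℕ → List C := fun q =>
      ((q.1 : B) :: List.replicate q.2 b).flatMap α with hα'
  have hsub : ∀ {p}, p ∈ Decomposable y α' → p ∈ Decomposable y α := fun h =>
    Decomposable.refine (fun _ => by simp) h
  have key : ∀ (p : ℤ) (i j : ℕ), i < j →
      p + ((List.replicate i b).flatMap α).length ∈ Decomposable y α' →
      Occurs y p ((List.replicate j b).flatMap α) →
      p + ((List.replicate j b).flatMap α).length ∈ Decomposable y α → False := by
    intro p i j hij h1 h2 h3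
    obtain ⟨k, rfl⟩ := Nat.exists_eq_add_of_lt hij
    rw [show i + k + 1 = i + (k + 1) by ring, List.replicate_add, List.flatMap_append] at h2 h3
    rw [occurs_append] at h2
    rw [List.length_append] at h3
    push_cast at h3
    rw [← add_assoc] at h3
    have h2' := h2.2
    rw [List.replicate_succ, List.flatMap_cons, occurs_append] at h2'
    rw [List.replicate_succ, List.flatMap_cons, List.length_append] at h3
    push_cast at h3
    rw [← add_assoc] at h3
    obtain ⟨⟨⟨z, hz⟩, l⟩, hd, hd'⟩ := Decomposable.exists_step h1
    have hd0 : Occurs y (p + ((List.replicate i b).flatMap α).length)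
      (α z ++ (List.replicate l b).flatMap α) := hd
    have hd1 : p + ((List.replicate i b).flatMap α).length +
      ((α z ++ (List.replicate l b).flatMap α).length : ℕ) ∈ Decomposable y α' := hd'
    rw [occurs_append] at hd0
    rw [List.length_append] at hd1
    push_cast at hd1
    rw [← add_assoc] at hd1
    exact hz (hα _ _ _ hd0.1 (Decomposable.append hd0.2 (hsub hd1)) h2'.1
      (Decomposable.append h2'.2 h3))
  rintro p ⟨⟨z, hz⟩, i⟩ ⟨⟨z', hz'⟩, j⟩ h1 h2 h3 h4
  have h1 : Occurs y p (α z ++ (List.replicate i b).flatMap α) := h1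
  have h3 : Occurs y p (α z' ++ (List.replicate j b).flatMap α) := h3
  have h2 : p + ((α z ++ (List.replicate i b).flatMap α).length : ℕ) ∈ Decomposable y α' := h2
  have h4 : p + ((α z' ++ (List.replicate j b).flatMap α).length : ℕ) ∈ Decomposable y α' := h4
  rw [occurs_append] at h1 h3
  rw [List.length_append] at h2 h4
  push_cast at h2 h4
  rw [← add_assoc] at h2 h4
  obtain rfl : z = z' := hα p z z' h1.1 (Decomposable.append h1.2 (hsub h2)) h3.1
    (Decomposable.append h3.2 (hsub h4))
  rcases lt_trichotomy i j with hij | rfl | hij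
  · exact (key _ i j hij h2 h3.2 (hsub h4)).elim
  · rfl
  · exact (key _ j i hij h4 h1.2 (hsub h2)).elim

/-- The words `f d` are products of words `α b` into which `y` is uniquely decomposable, and
all the letters `b` needed are initial letters. -/
theorem exists_uniquelyDecomposable_factorization {C : Type u} {D : Type*} [Fintype D]
    (y : ℤ → C) (f : D → List C) :
    ∃ (B : Type u) (α : B → List C) (β : D → List B), UniquelyDecomposable y α ∧
      (∀ d, f d = (β d).flatMap α) ∧ ∀ d, ∀ b ∈ β d, ∃ d', (β d').head? = some b := by
  classical
  -- A factorization of minimal total length is taken; single letters provide a first one. If `b` is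
  -- used but is never initial, passing to the blocks z b^i shortens it. `B` may be infinite: only
  -- the letters used matter later.
  have hex : ∃ (n : ℕ) (B : Type u) (α : B → List C) (β : D → List B), UniquelyDecomposable y α ∧
      (∀ d, f d = (β d).flatMap α) ∧ ∑ d, (β d).length = n := by
    refine ⟨_, C, fun c => [c], f, ?_, fun d => by simp, rfl⟩
    intro p b b' h _ h' _
    have h1 := h 0 (by simp)
    have h2 := h' 0 (by simp)
    simp at h1 h2
    rw [← h1, h2]
  obtain ⟨B, α, β, hα, hf, hn⟩ := Nat.find_spec hex
  refine ⟨B, α, β, hα, hf, ?_⟩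
  intro d b hb
  by_contra! hne
  choose i w' hw hl using fun d => exists_blocks b (β d)
  have hi : ∀ d, i d = 0 := by
    intro d
    by_contra h0
    obtain ⟨k, hk⟩ := Nat.exists_eq_succ_of_ne_zero h0
    apply hne d
    rw [hw d, hk]
    simp [List.replicate_succ]
  refine Nat.find_min hex (m := ∑ d, (w' d).length) ?_ ⟨_, _, w', hα.blocks b, ?_, rfl⟩
  · rw [← hn]
    refine Finset.sum_lt_sum (fun d _ => by rw [hl]; exact List.countP_le_length)
      ⟨d, Finset.mem_univ _, ?_⟩
    rw [hl]
    refine lt_of_le_of_ne List.countP_le_length fun h => ?_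
    rw [List.countP_eq_length] at h
    simpa using h b hb
  · intro d
    rw [hf d]
    conv_lhs => rw [hw d, hi d]
    simp [List.flatMap_assoc]

/-- The words `f a` are products of words of a set of `k` words. -/
def FactorsThrough {A : Type*} (f : A → List C) (k : ℕ) : Prop :=
  ∃ (α : Fin k → List C) (β : A → List (Fin k)), ∀ a, f a = (β a).flatMap α

theorem FactorsThrough.of_finite {A B : Type*} [Finite B] {f : A → List C} (α : B → List C)
    (β : A → List B) (h : ∀ a, f a = (β a).flatMap α) : FactorsThrough f (Nat.card B) := by
  refine ⟨α ∘ (Finite.equivFin B).symm, fun a => (β a).map (Finite.equivFin B), fun a => ?_⟩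
  rw [h, List.flatMap_map]
  simp

/-- The initial letters suffice as alphabet, and taking the initial letter maps `A` onto them
without being injective, since `a₁` and `a₂` collide. -/
theorem factorsThrough_of_head {A B : Type*} [Finite A] {f : A → List C} {α : B → List C}
    {β : A → List B} (hf : ∀ a, f a = (β a).flatMap α)
    (hh : ∀ a, ∀ b ∈ β a, ∃ a', (β a').head? = some b) {a₁ a₂ : A} (hne : a₁ ≠ a₂)
    (h12 : (β a₁).head? = (β a₂).head?) (h1 : β a₁ ≠ []) :
    ∃ k < Nat.card A, FactorsThrough f k := by
  classical
  set H : Set B := {b | ∃ a, (β a).head? = some b} with hH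
  obtain ⟨b₁, hb₁⟩ : ∃ b, (β a₁).head? = some b := by
    obtain ⟨b, w, hbw⟩ := List.exists_cons_of_ne_nil h1
    exact ⟨b, by rw [hbw]; rfl⟩
  -- An index whose word is empty has no initial letter; it is sent to that of `a₁`.
  let g : A → H := fun a => if h : ∃ b, (β a).head? = some b then ⟨h.choose, a, h.choose_spec⟩
    else ⟨b₁, a₁, hb₁⟩
  have hg : ∀ a b, (β a).head? = some b → (g a : B) = b := by
    intro a b hab
    have h : ∃ b, (β a).head? = some b := ⟨b, hab⟩
    have : g a = ⟨h.choose, a, h.choose_spec⟩ := dif_pos h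
    rw [this]
    exact Option.some.inj (h.choose_spec.symm.trans hab)
  have hsurj : Function.Surjective g := by
    rintro ⟨b, a, hab⟩
    exact ⟨a, Subtype.ext (hg a b hab)⟩
  have : Finite H := Finite.of_surjective g hsurj
  refine ⟨Nat.card H, ?_, FactorsThrough.of_finite (fun b : H => α b)
    (fun a => (β a).attachWith (· ∈ H) (fun b hb => hh a b hb)) ?_⟩
  · refine lt_of_le_of_ne (Nat.card_le_card_of_surjective g hsurj) fun h => ?_
    have hbij := (Nat.bijective_iff_surjective_and_card g).2 ⟨hsurj, h.symm⟩
    exact hne (hbij.1 (Subtype.ext (by rw [hg a₁ b₁ hb₁, hg a₂ b₁ (h12 ▸ hb₁)])))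
  · intro a
    rw [hf]
    conv_lhs => rw [← List.attachWith_map_subtype_val (p := (· ∈ H)) (l := β a)
      (fun b hb => hh a b hb)]
    rw [List.flatMap_map]

/-- Both decompositions refine to decompositions into words `α b` from the same position, where the
first letter is unique. -/
theorem head_eq_of_decomposable {B D : Type*} {y : ℤ → C} {f : D → List C} {α : B → List C}
    {β : D → List B} (hα : UniquelyDecomposable y α) (hf : ∀ d, f d = (β d).flatMap α)
    (hne : ∀ d, β d ≠ []) {p : ℤ} {d d' : D}
    (h1 : Occurs y p (f d)) (h2 : p + (f d).length ∈ Decomposable y f)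
    (h3 : Occurs y p (f d')) (h4 : p + (f d').length ∈ Decomposable y f) :
    (β d).head? = (β d').head? := by
  have hf' : f = fun d => (β d).flatMap α := funext hf
  have hsub : ∀ {q}, q ∈ Decomposable y f → q ∈ Decomposable y α := fun h =>
    Decomposable.refine hne (hf' ▸ h)
  have key : ∀ d, Occurs y p (f d) → p + (f d).length ∈ Decomposable y f → ∃ b,
      (β d).head? = some b ∧ Occurs y p (α b) ∧ p + (α b).length ∈ Decomposable y α := by
    intro d h1 h2
    obtain ⟨b, w, hbw⟩ := List.exists_cons_of_ne_nil (hne d)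
    have h2 := hsub h2
    rw [hf, hbw, List.flatMap_cons] at h1 h2
    rw [occurs_append] at h1
    rw [List.length_append] at h2
    push_cast at h2
    rw [← add_assoc] at h2
    exact ⟨b, by rw [hbw]; rfl, h1.1, Decomposable.append h1.2 h2⟩
  obtain ⟨b, e, h5, h6⟩ := key d h1 h2
  obtain ⟨b', e', h7, h8⟩ := key d' h3 h4
  rw [e, e', hα p b b' h5 h6 h7 h8]

/-- Defect theorem for right-infinite words. -/
theorem eq_of_decomposable {A : Type*} [Finite A] {y : ℤ → C} {f : A → List C}
    (hf : ∀ k < Nat.card A, ¬ FactorsThrough f k) (hne : ∀ a, f a ≠ []) {p : ℤ} {a a' : A}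
    (h1 : Occurs y p (f a)) (h2 : p + (f a).length ∈ Decomposable y f)
    (h3 : Occurs y p (f a')) (h4 : p + (f a').length ∈ Decomposable y f) : a = a' := by
  have := Fintype.ofFinite A
  obtain ⟨B, α, β, hα, hfβ, hh⟩ := exists_uniquelyDecomposable_factorization y f
  have hβ : ∀ a, β a ≠ [] := fun a h => hne a (by rw [hfβ, h]; rfl)
  by_contra haa
  obtain ⟨k, hk, hk'⟩ := factorsThrough_of_head hfβ hh haa
    (head_eq_of_decomposable hα hfβ hβ h1 h2 h3 h4) (hβ a)
  exact hf k hk hk'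

theorem Decomposable.mono {A D : Type*} {y : ℤ → C} {f : A → List C} {g : D → List C}
    (h : ∀ a, ∃ d, g d = f a) {p : ℤ} (hp : p ∈ Decomposable y f) : p ∈ Decomposable y g := by
  obtain ⟨S, hpS, hS⟩ := hp
  refine ⟨S, hpS, fun q hq => ?_⟩
  obtain ⟨a, ha⟩ := hS q hq
  obtain ⟨d, hd⟩ := h a
  exact ⟨d, by rwa [hd]⟩

/-- Two occurrences of the same word `v`, each between a cut of one decomposition and a cut of
another one, are the beginnings of blocks of the same letter. -/
theorem eq_of_decomposable_of_overhang {A : Type*} [Finite A] {y : ℤ → C} {f : A → List C}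
    (hf : ∀ k < Nat.card A, ¬ FactorsThrough f k) (hne : ∀ a, f a ≠ []) {v : List C}
    (hv : v ≠ []) {p p' : ℤ} {a a' : A}
    (h1 : Occurs y p (f a)) (h2 : p + (f a).length ∈ Decomposable y f)
    (h3 : Occurs y p v) (h4 : p + v.length ∈ Decomposable y f)
    (h1' : Occurs y p' (f a')) (h2' : p' + (f a').length ∈ Decomposable y f)
    (h3' : Occurs y p' v) (h4' : p' + v.length ∈ Decomposable y f) : a = a' := by
  have := Fintype.ofFinite A
  -- The overhang `v` is added as one more word. Its head coincides with those of `a` and `a'`, so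
  -- it contributes no new initial letter, while `a` and `a'` share theirs: fewer than Card A
  -- letters remain.
  let g : Option A → List C := fun d => d.elim v f
  have hg : ∀ {q}, q ∈ Decomposable y f → q ∈ Decomposable y g := fun h =>
    Decomposable.mono (fun a => ⟨some a, rfl⟩) h
  obtain ⟨B, α, β, hα, hfβ, hh⟩ := exists_uniquelyDecomposable_factorization y g
  have hβ : ∀ d, β d ≠ [] := by
    intro d h
    have h0 : g d = [] := by rw [hfβ, h]; rfl
    rcases d with _ | a
    · exact hv h0
    · exact hne a h0
  by_contra haa
  have e1 : (β none).head? = (β (some a)).head? :=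
    head_eq_of_decomposable (d := none) (d' := some a) hα hfβ hβ h3 (hg h4) h1 (hg h2)
  have e2 : (β none).head? = (β (some a')).head? :=
    head_eq_of_decomposable (d := none) (d' := some a') hα hfβ hβ h3' (hg h4') h1' (hg h2')
  obtain ⟨k, hk, hk'⟩ := factorsThrough_of_head (f := f) (α := α) (β := fun a => β (some a))
    (fun a => hfβ (some a)) (by
      intro c b hb
      obtain ⟨d, hd⟩ := hh _ b hb
      rcases d with _ | d
      · exact ⟨a, by rw [← e1, hd]⟩
      · exact ⟨d, hd⟩) haa (e1.symm.trans e2) (hβ _)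
  exact hf k hk hk'

end Defect

/-! ### Deterministic two-sided sequences with finitely many states -/

/-- A two-sided sequence in a finite set that stays in `D` once it is there, and that is
deterministic outside of `D`, is periodic or stays in `D`. -/
theorem forall_mem_or_periodic {S : Type*} (s : ℤ → S) (hs : (Set.range s).Finite) (D : Set S)
    (h1 : ∀ i, s i ∈ D → s (i + 1) ∈ D)
    (h2 : ∀ i j, s i = s j → s i ∉ D → s (i + 1) = s (j + 1) ∨ s (i + 1) ∈ D ∧ s (j + 1) ∈ D) :
    (∀ i, s i ∈ D) ∨ ∃ q : ℕ, 1 ≤ q ∧ ∀ i, s (i + q) = s i := by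
  by_contra! hcon
  obtain ⟨⟨i₀, hi₀⟩, hper⟩ := hcon
  have hup : ∀ i, s i ∈ D → ∀ n : ℕ, s (i + n) ∈ D := by
    intro i hi n
    induction n with
    | zero => simpa using hi
    | succ n ih =>
      have := h1 _ ih
      push_cast
      rwa [← add_assoc]
  have hup' : ∀ i j, i ≤ j → s i ∈ D → s j ∈ D := by
    intro i j hij hi
    have := hup i hi (j - i).toNat
    rwa [Int.toNat_of_nonneg (by omega), add_sub_cancel] at this
  -- a value that is taken at arbitrarily small positions
  obtain ⟨a, ha⟩ : ∃ a, ∀ N : ℤ, ∃ i ≤ N, s i = a := by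
    by_contra! hno
    choose N hN using hno
    obtain ⟨M, hM⟩ := (hs.image N).bddBelow
    exact hN (s M) M (hM ⟨s M, ⟨M, rfl⟩, rfl⟩) rfl
  have hfwd : ∀ i j, i < j → s i = a → s j = a → ∀ n : ℕ,
      s (i + n) = s (j + n) ∧ s (i + n) ∉ D := by
    intro i j hij hi hj n
    induction n with
    | zero =>
      obtain ⟨l, hl, hla⟩ := ha i₀
      have : a ∉ D := fun h => hi₀ (hup' l i₀ hl (hla ▸ h))
      simpa [hi, hj] using this
    | succ n ih =>
      push_cast
      rw [← add_assoc, ← add_assoc]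
      -- Since i < j, position i + n + 1 is at most j + n, where the sequence is still outside of
      -- `D`; being outside passes to the left.
      have hni : s (i + n + 1) ∉ D := fun h =>
        ih.2 (ih.1 ▸ hup' (i + n + 1) (j + n) (by omega) h)
      rcases h2 _ _ ih.1 ih.2 with h | h
      · exact ⟨h, hni⟩
      · exact absurd h.1 hni
  have hall : ∀ i j, s i = a → s j = a → ∀ n : ℕ, s (i + n) = s (j + n) := by
    intro i j hi hj n
    rcases lt_trichotomy i j with h | rfl | h
    · exact (hfwd i j h hi hj n).1
    · rfl
    · exact (hfwd j i h hj hi n).1.symm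
  obtain ⟨j, -, hj⟩ := ha 0
  -- The distance of two occurrences of `a` is a period: any `l` lies to the right of some further
  -- occurrence `t`, from which the sequence continues as from `i` and from `j`.
  obtain ⟨i, hij, hi⟩ := ha (j - 1)
  obtain ⟨l, hl⟩ := hper (j - i).toNat (by omega)
  obtain ⟨t, ht, hta⟩ := ha l
  apply hl
  have e1 := hall t i hta hi (l - t + (j - i)).toNat
  have e2 := hall t j hta hj (l - t).toNat
  rw [Int.toNat_of_nonneg (by omega)] at e1 e2 ⊢
  rw [show l + (j - i) = t + (l - t + (j - i)) by ring, e1,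
    show i + (l - t + (j - i)) = j + (l - t) by ring, ← e2]
  congr 1
  ring

/-! ### Tilings of a two-sided sequence by blocks -/

section Tiling

variable {A C : Type*}

/-- `s i` is the letter and the offset of position `i` in a decomposition of the two-sided
sequence `y` into blocks `f a`. -/
structure IsTiling (f : A → List C) (y : ℤ → C) (s : ℤ → A × ℕ) : Prop where
  lt : ∀ i, (s i).2 < (f (s i).1).length
  val : ∀ i, (f (s i).1)[(s i).2]? = some (y i)
  next : ∀ i, (s i).2 + 1 < (f (s i).1).length → s (i + 1) = ((s i).1, (s i).2 + 1)
  last : ∀ i, (s i).2 + 1 = (f (s i).1).length → (s (i + 1)).2 = 0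

variable {f : A → List C} {y : ℤ → C} {s s' : ℤ → A × ℕ}

theorem IsTiling.add (h : IsTiling f y s) (p : ℤ) (j : ℕ)
    (hj : (s p).2 + j < (f (s p).1).length) : s (p + j) = ((s p).1, (s p).2 + j) := by
  induction j with
  | zero => simp
  | succ j ih =>
    have ih := ih (by omega)
    push_cast
    rw [← add_assoc, h.next _ (by rw [ih]; exact hj), ih]
    rfl

theorem IsTiling.add_last (h : IsTiling f y s) (p : ℤ) :
    (s (p + ((f (s p).1).length - (s p).2 : ℕ))).2 = 0 := by
  have hlt := h.lt p
  obtain ⟨j, hj⟩ := Nat.exists_eq_add_of_lt hlt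
  have h1 := h.add p j (by omega)
  have : (f (s p).1).length - (s p).2 = j + 1 := by omega
  rw [this]
  push_cast
  rw [← add_assoc]
  exact h.last _ (by rw [h1]; simp only; omega)

theorem IsTiling.occurs (h : IsTiling f y s) (p : ℤ) :
    Occurs y p ((f (s p).1).drop (s p).2) := by
  intro j hj
  rw [List.length_drop] at hj
  have h1 := h.add p j (by omega)
  have h2 := h.val (p + j)
  rw [h1] at h2
  rw [List.getElem_drop]
  rw [List.getElem?_eq_getElem (by simp only; omega)] at h2
  exact (Option.some.inj h2).symm

theorem IsTiling.decomposable (h : IsTiling f y s) {p : ℤ} (hp : (s p).2 = 0) :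
    p ∈ Decomposable y f := by
  refine ⟨{q | (s q).2 = 0}, hp, fun q hq => ⟨(s q).1, ?_, ?_⟩⟩
  · have := h.occurs q
    rwa [hq, List.drop_zero] at this
  · have := h.add_last q
    rwa [hq, Nat.sub_zero] at this

theorem IsTiling.occurs_zero (h : IsTiling f y s) {p : ℤ} (hp : (s p).2 = 0) :
    Occurs y p (f (s p).1) := by
  have := h.occurs p
  rwa [hp, List.drop_zero] at this

theorem IsTiling.decomposable_zero (h : IsTiling f y s) {p : ℤ} (hp : (s p).2 = 0) :
    p + (f (s p).1).length ∈ Decomposable y f := by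
  have := h.add_last p
  rw [hp, Nat.sub_zero] at this
  exact h.decomposable this

theorem IsTiling.next_or_last (h : IsTiling f y s) (i : ℤ) :
    (s i).2 + 1 < (f (s i).1).length ∨ (s i).2 + 1 = (f (s i).1).length := by
  have := h.lt i
  omega

theorem IsTiling.finite_range [Finite A] (h : IsTiling f y s) : (Set.range s).Finite := by
  refine ((Set.finite_univ (α := A)).biUnion fun a _ =>
    (Set.finite_Iio (f a).length).image (Prod.mk a)).subset ?_
  rintro _ ⟨i, rfl⟩
  simp only [Set.mem_iUnion]
  exact ⟨(s i).1, Set.mem_univ _, (s i).2, h.lt i, rfl⟩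

/-- The letter of a block that begins inside of a block of another decomposition is determined by
that other block and the position in it. -/
theorem IsTiling.eq_of_overhang [Finite A] (hf : ∀ k < Nat.card A, ¬ FactorsThrough f k)
    (hne : ∀ a, f a ≠ []) (h : IsTiling f y s) (h' : IsTiling f y s') {i j : ℤ}
    (hij' : s' i = s' j) (hi : (s (i + 1)).2 = 0) (hj : (s (j + 1)).2 = 0)
    (hi' : (s' i).2 + 1 < (f (s' i).1).length) :
    s (i + 1) = s (j + 1) ∧ s' (i + 1) = s' (j + 1) := by
  have e1 := h'.next i hi'
  have e2 := h'.next j (hij' ▸ hi')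
  refine ⟨Prod.ext ?_ (hi.trans hj.symm), by rw [e1, e2, hij']⟩
  have key : ∀ i, (s' i).2 + 1 < (f (s' i).1).length →
      Occurs y (i + 1) ((f (s' i).1).drop ((s' i).2 + 1)) ∧
      i + 1 + ((f (s' i).1).drop ((s' i).2 + 1)).length ∈ Decomposable y f := by
    intro i hi
    have e := h'.next i hi
    have o := h'.occurs (i + 1)
    have d := h'.decomposable (h'.add_last (i + 1))
    rw [e] at o d
    exact ⟨o, by rwa [List.length_drop]⟩
  have k1 := key i hi'
  have k2 := key j (hij' ▸ hi')
  rw [← hij'] at k2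
  refine eq_of_decomposable_of_overhang hf hne ?_ (h.occurs_zero hi) (h.decomposable_zero hi)
    k1.1 k1.2 (h.occurs_zero hj) (h.decomposable_zero hj) k2.1 k2.2
  intro h0
  rw [List.drop_eq_nil_iff] at h0
  omega

/-- An aperiodic sequence has at most one decomposition into the blocks `f a` if these are not
products of words of a smaller set. -/
theorem IsTiling.eq_of_not_isPeriodic [Finite A] (hf : ∀ k < Nat.card A, ¬ FactorsThrough f k)
    (hne : ∀ a, f a ≠ []) (hy : ¬ IsPeriodic y) (h : IsTiling f y s) (h' : IsTiling f y s') :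
    s = s' := by
  have hend : ∀ i, (s i).2 + 1 = (f (s i).1).length → (s' i).2 + 1 = (f (s' i).1).length →
      s (i + 1) = s' (i + 1) := by
    intro i hi hi'
    have e := h.last i hi
    have e' := h'.last i hi'
    refine Prod.ext ?_ (e.trans e'.symm)
    exact eq_of_decomposable hf hne (h.occurs_zero e) (h.decomposable_zero e)
      (h'.occurs_zero e') (h'.decomposable_zero e')
  have hfin : (Set.range fun i => (s i, s' i)).Finite := by
    refine (h.finite_range.prod h'.finite_range).subset ?_
    rintro _ ⟨i, rfl⟩
    exact ⟨⟨i, rfl⟩, ⟨i, rfl⟩⟩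
  -- The states are pairs of tiles and `D` is the diagonal. Off the diagonal, the next pair is
  -- forced unless both blocks end, and then it lies in `D` by the defect theorem.
  have hdet := forall_mem_or_periodic _ hfin {t | t.1 = t.2} ?_ ?_
  · rcases hdet with hD | ⟨q, hq, hp⟩
    · exact funext hD
    refine absurd ⟨q, hq, funext fun i => ?_⟩ hy
    have e := congrArg Prod.fst (hp i)
    simp only at e
    have v := h.val (i + q)
    rw [e, h.val i] at v
    exact (Option.some.inj v).symm
  · intro i hi
    have hi : s i = s' i := hi
    change s (i + 1) = s' (i + 1)
    rcases h.next_or_last i with h1 | h1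
    · rw [h.next i h1, h'.next i (hi ▸ h1), hi]
    · exact hend i h1 (hi ▸ h1)
  · intro i j hij _
    have e : s i = s j := congrArg Prod.fst hij
    have e' : s' i = s' j := congrArg Prod.snd hij
    rcases h.next_or_last i with h1 | h1 <;> rcases h'.next_or_last i with h2 | h2
    · left
      rw [h.next i h1, h'.next i h2, h.next j (e ▸ h1), h'.next j (e' ▸ h2), e, e']
    · left
      obtain ⟨a, b⟩ := IsTiling.eq_of_overhang hf hne h' h e (h'.last i h2)
        (h'.last j (e' ▸ h2)) h1
      exact Prod.ext b a
    · left
      obtain ⟨a, b⟩ := IsTiling.eq_of_overhang hf hne h h' e' (h.last i h1)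
        (h.last j (e ▸ h1)) h2
      exact Prod.ext a b
    · exact Or.inr ⟨hend i h1 h2, hend j (e ▸ h1) (e' ▸ h2)⟩

end Tiling

/-! ### Images of two-sided sequences under possibly erasing morphisms -/

section Image

variable {A B C : Type*}

theorem shift_shift (k l : ℤ) (x : ℤ → A) : shift k (shift l x) = shift (k + l) x := by
  funext n
  simp only [shift, add_assoc]

theorem shift_zero (x : ℤ → A) : shift 0 x = x := by
  funext n
  simp only [shift, add_zero]

theorem occurs_shift {y : ℤ → A} {k p : ℤ} {w : List A} :
    Occurs (shift k y) p w ↔ Occurs y (p + k) w := by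
  refine forall_congr' fun j => forall_congr' fun h => ?_
  rw [shift, add_right_comm]

theorem occurs_word (x : ℤ → A) (i j : ℤ) : Occurs x i (word x i j).toList := by
  intro n hn
  simp [word]

theorem length_word (x : ℤ → A) (i j : ℤ) : (word x i j).length = (j - i).toNat := by
  change (word x i j).toList.length = _
  simp [word]

theorem Occurs.word_eq {x : ℤ → A} {i j : ℤ} {w : FreeMonoid A} (h : Occurs x i w.toList)
    (hj : j - i = w.length) : word x i j = w := by
  have hl : w.length = w.toList.length := rfl
  apply FreeMonoid.toList.injective
  refine List.ext_getElem ?_ fun n h1 h2 => ?_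
  · have := length_word x i j
    rw [hj, Int.toNat_natCast] at this
    exact this
  · rw [← occurs_word x i j n h1, h n h2]

section BlockStart

variable (σ : FreeMonoid A →* FreeMonoid B) (x : ℤ → A)

theorem blockStart_zero : blockStart σ x 0 = 0 := by simp [blockStart]

theorem blockStart_succ (n : ℤ) : blockStart σ x (n + 1) =
    blockStart σ x n + (σ (FreeMonoid.of (x n))).length := by
  unfold blockStart
  rcases le_or_gt 0 n with hn | hn
  · have h1 : Finset.Ico 0 (n + 1) = insert n (Finset.Ico 0 n) := by
      ext i; simp only [Finset.mem_Ico, Finset.mem_insert]; omega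
    have h2 : Finset.Ico (n + 1) 0 = ∅ := Finset.Ico_eq_empty (by omega)
    have h3 : Finset.Ico n 0 = ∅ := Finset.Ico_eq_empty (by omega)
    rw [h1, h2, h3, Finset.sum_insert (by simp)]
    simp only [Finset.sum_empty]
    ring
  · have h1 : Finset.Ico n 0 = insert n (Finset.Ico (n + 1) 0) := by
      ext i; simp only [Finset.mem_Ico, Finset.mem_insert]; omega
    have h2 : Finset.Ico 0 (n + 1) = ∅ := Finset.Ico_eq_empty (by omega)
    have h3 : Finset.Ico 0 n = ∅ := Finset.Ico_eq_empty (by omega)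
    rw [h1, h2, h3, Finset.sum_insert (by simp)]
    simp only [Finset.sum_empty]
    ring

/-- This recursion replaces the two sums in the definition of `blockStart`. -/
theorem eq_blockStart {g : ℤ → ℤ} (h0 : g 0 = 0)
    (h : ∀ n, g (n + 1) = g n + (σ (FreeMonoid.of (x n))).length) (n : ℤ) :
    g n = blockStart σ x n := by
  induction n using Int.induction_on with
  | zero => rw [h0, blockStart_zero]
  | succ n ih => rw [h, ih, blockStart_succ]
  | pred n ih =>
    have e1 := h (-n - 1)
    have e2 := blockStart_succ σ x (-n - 1)
    rw [sub_add_cancel] at e1 e2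
    omega

theorem blockStart_mono : Monotone (blockStart σ x) :=
  monotone_int_of_le_succ fun n => by rw [blockStart_succ]; omega

theorem blockStart_shift (l n : ℤ) :
    blockStart σ (shift l x) n = blockStart σ x (n + l) - blockStart σ x l := by
  refine (eq_blockStart σ (shift l x) (g := fun n => blockStart σ x (n + l) - blockStart σ x l)
    (by simp) (fun n => ?_) n).symm
  simp only [shift]
  rw [add_right_comm, blockStart_succ]
  ring

end BlockStart

variable {σ : FreeMonoid A →* FreeMonoid B} {x : ℤ → A} {y : ℤ → B}

theorem toList_map (σ : FreeMonoid A →* FreeMonoid B) (w : List A) :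
    (σ (FreeMonoid.ofList w)).toList = w.flatMap fun a => (σ (FreeMonoid.of a)).toList := by
  induction w with
  | nil => rw [FreeMonoid.ofList_nil, map_one]; rfl
  | cons a w ih => rw [FreeMonoid.ofList_cons, map_mul, FreeMonoid.toList_mul, ih]; rfl

theorem one_le_length {w : FreeMonoid A} (h : w ≠ 1) : 1 ≤ w.length := by
  rw [Nat.one_le_iff_ne_zero]
  exact fun h0 => h (FreeMonoid.length_eq_zero.1 h0)

theorem isImage_iff : IsImage σ x y ↔ InDomain σ x ∧
    ∀ n, Occurs y (blockStart σ x n) (σ (FreeMonoid.of (x n))).toList := by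
  refine and_congr_right fun _ => forall_congr' fun n => ⟨fun h => ?_, fun h => ?_⟩
  · rw [← h]
    exact occurs_word _ _ _
  · exact h.word_eq (by rw [blockStart_succ]; ring)

theorem blockStart_add_length {i : ℤ} {w : List A} (h : Occurs x i w) :
    blockStart σ x (i + w.length) =
      blockStart σ x i + (w.flatMap fun a => (σ (FreeMonoid.of a)).toList).length := by
  induction w generalizing i with
  | nil => simp
  | cons a w ih =>
    rw [← List.singleton_append, occurs_append] at h
    have h0 : x i = a := by simpa using h.1 0 (by simp)
    rw [List.length_cons, List.flatMap_cons, List.length_append]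
    push_cast
    have := ih h.2
    rw [List.length_singleton, Nat.cast_one, blockStart_succ, h0] at this
    rw [show i + ((w.length : ℤ) + 1) = i + 1 + w.length by ring, this, add_assoc]
    rfl

theorem IsImage.occurs (h : IsImage σ x y) {i : ℤ} {w : List A} (hw : Occurs x i w) :
    Occurs y (blockStart σ x i) (w.flatMap fun a => (σ (FreeMonoid.of a)).toList) := by
  induction w generalizing i with
  | nil => exact occurs_nil _ _
  | cons a w ih =>
    rw [← List.singleton_append, occurs_append] at hw
    have h0 : x i = a := by simpa using hw.1 0 (by simp)
    have h1 := (isImage_iff.1 h).2 i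
    have h2 := ih hw.2
    rw [List.length_singleton, Nat.cast_one, blockStart_succ] at h2
    rw [List.flatMap_cons, occurs_append]
    rw [h0] at h1 h2
    exact ⟨h1, h2⟩

theorem InDomain.exists_le_blockStart (h : InDomain σ x) (k : ℕ) :
    ∃ n, (k : ℤ) ≤ blockStart σ x n := by
  induction k with
  | zero => exact ⟨0, by rw [blockStart_zero]; rfl⟩
  | succ k ih =>
    obtain ⟨n, hn⟩ := ih
    obtain ⟨i, hi, hi'⟩ := h.2 n
    refine ⟨i + 1, ?_⟩
    have := blockStart_mono σ x hi
    have := one_le_length hi'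
    rw [blockStart_succ]
    push_cast
    omega

theorem InDomain.exists_blockStart_le (h : InDomain σ x) (k : ℕ) :
    ∃ n, blockStart σ x n ≤ -(k : ℤ) := by
  induction k with
  | zero => exact ⟨0, by rw [blockStart_zero]; rfl⟩
  | succ k ih =>
    obtain ⟨n, hn⟩ := ih
    obtain ⟨i, hi, hi'⟩ := h.1 (n - 1)
    refine ⟨i, ?_⟩
    have := blockStart_mono σ x (show i + 1 ≤ n by omega)
    have := one_le_length hi'
    have := blockStart_succ σ x i
    push_cast
    omega

theorem InDomain.exists_block (h : InDomain σ x) (i : ℤ) :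
    ∃ n, blockStart σ x n ≤ i ∧ i < blockStart σ x (n + 1) := by
  obtain ⟨a, ha⟩ := h.exists_blockStart_le i.natAbs
  obtain ⟨b, hb⟩ := h.exists_le_blockStart (i.natAbs + 1)
  obtain ⟨n, hn, hn'⟩ := Int.exists_greatest_of_bdd (P := fun n => blockStart σ x n ≤ i)
    ⟨b, fun z hz => by
      by_contra! hlt
      have := blockStart_mono σ x hlt.le
      omega⟩ ⟨a, by omega⟩
  refine ⟨n, hn, ?_⟩
  by_contra! hlt
  have := hn' _ hlt
  omega

theorem block_unique {i n n' : ℤ} (h1 : blockStart σ x n ≤ i) (h2 : i < blockStart σ x (n + 1))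
    (h1' : blockStart σ x n' ≤ i) (h2' : i < blockStart σ x (n' + 1)) : n = n' := by
  rcases lt_trichotomy n n' with h | h | h
  · have := blockStart_mono σ x (show n + 1 ≤ n' by omega)
    omega
  · exact h
  · have := blockStart_mono σ x (show n' + 1 ≤ n by omega)
    omega

theorem IsImage.exists_getElem (h : IsImage σ x y) {i n : ℤ} (h1 : blockStart σ x n ≤ i)
    (h2 : i < blockStart σ x (n + 1)) :
    (σ (FreeMonoid.of (x n))).toList[(i - blockStart σ x n).toNat]? = some (y i) := by
  rw [blockStart_succ] at h2
  have hlt : (i - blockStart σ x n).toNat < (σ (FreeMonoid.of (x n))).toList.length := by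
    change _ < (σ (FreeMonoid.of (x n))).length
    omega
  rw [List.getElem?_eq_getElem hlt, ← (isImage_iff.1 h).2 n _ hlt]
  congr 2
  omega

theorem IsImage.unique {y' : ℤ → B} (h : IsImage σ x y) (h' : IsImage σ x y') : y = y' := by
  funext i
  obtain ⟨n, h1, h2⟩ := h.1.exists_block i
  exact Option.some.inj ((h.exists_getElem h1 h2).symm.trans (h'.exists_getElem h1 h2))

theorem InDomain.exists_image (h : InDomain σ x) : ∃ y, IsImage σ x y := by
  choose n h1 h2 using h.exists_block
  have hlt : ∀ i, (i - blockStart σ x (n i)).toNat <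
      (σ (FreeMonoid.of (x (n i)))).toList.length := by
    intro i
    have e1 := h1 i
    have e2 := h2 i
    rw [blockStart_succ] at e2
    change _ < (σ (FreeMonoid.of (x (n i)))).length
    omega
  refine ⟨fun i => (σ (FreeMonoid.of (x (n i)))).toList[(i - blockStart σ x (n i)).toNat]'(hlt i),
    isImage_iff.2 ⟨h, fun m j hj => ?_⟩⟩
  have hj' : j < (σ (FreeMonoid.of (x m))).length := hj
  have hm : n (blockStart σ x m + j) = m :=
    block_unique (h1 _) (h2 _) (by omega) (by rw [blockStart_succ]; omega)
  simp only [hm]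
  congr 1
  omega

theorem IsImage.map_shift (h : IsImage σ x y) (l : ℤ) :
    IsImage σ (shift l x) (shift (blockStart σ x l) y) := by
  refine isImage_iff.2 ⟨⟨fun N => ?_, fun N => ?_⟩, fun n => ?_⟩
  · obtain ⟨i, hi, hi'⟩ := h.1.1 (N + l)
    exact ⟨i - l, by omega, by rwa [shift, sub_add_cancel]⟩
  · obtain ⟨i, hi, hi'⟩ := h.1.2 (N + l)
    exact ⟨i - l, by omega, by rwa [shift, sub_add_cancel]⟩
  · rw [occurs_shift, blockStart_shift, sub_add_cancel]
    exact (isImage_iff.1 h).2 (n + l)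

section Composition

variable {α : FreeMonoid A →* FreeMonoid B} {τ : FreeMonoid B →* FreeMonoid C}
  {z : ℤ → A} {x : ℤ → B} {y : ℤ → C}

theorem toList_comp (τ : FreeMonoid B →* FreeMonoid C) (α : FreeMonoid A →* FreeMonoid B) (a : A) :
    ((τ.comp α) (FreeMonoid.of a)).toList =
      (α (FreeMonoid.of a)).toList.flatMap fun b => (τ (FreeMonoid.of b)).toList := by
  rw [← toList_map]
  rfl

theorem IsImage.blockStart_comp (h : IsImage α z x) (τ : FreeMonoid B →* FreeMonoid C) (n : ℤ) :
    blockStart (τ.comp α) z n = blockStart τ x (blockStart α z n) := by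
  refine (eq_blockStart (τ.comp α) z (g := fun n => blockStart τ x (blockStart α z n))
    (by simp [blockStart_zero]) (fun n => ?_) n).symm
  have := blockStart_add_length (σ := τ) ((isImage_iff.1 h).2 n)
  rw [← toList_comp] at this
  rw [blockStart_succ]
  exact this

theorem IsImage.ne_one_comp (h : IsImage α z x) {j n : ℤ} (h1 : blockStart α z n ≤ j)
    (h2 : j < blockStart α z (n + 1)) (hj : τ (FreeMonoid.of (x j)) ≠ 1) :
    (τ.comp α) (FreeMonoid.of (z n)) ≠ 1 := by
  intro h0
  have e := h.blockStart_comp τ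
  have e1 := blockStart_succ (τ.comp α) z n
  rw [h0, e, e] at e1
  have := blockStart_mono τ x h1
  have := blockStart_mono τ x (show j + 1 ≤ _ from h2)
  have := one_le_length hj
  have := blockStart_succ τ x j
  have : (1 : FreeMonoid C).length = 0 := rfl
  omega

theorem IsImage.exists_ne_one (h : IsImage α z x) {n : ℤ}
    (hn : (τ.comp α) (FreeMonoid.of (z n)) ≠ 1) : ∃ j, blockStart α z n ≤ j ∧
      j < blockStart α z (n + 1) ∧ τ (FreeMonoid.of (x j)) ≠ 1 := by
  by_contra! hno
  apply hn
  apply FreeMonoid.toList.injective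
  rw [toList_comp]
  refine List.flatMap_eq_nil_iff.2 fun b hb => ?_
  obtain ⟨j, hj, rfl⟩ := List.getElem_of_mem hb
  have hj' : j < (α (FreeMonoid.of (z n))).length := hj
  rw [← (isImage_iff.1 h).2 n j hj, hno _ (by omega) (by rw [blockStart_succ]; omega)]
  rfl

theorem IsImage.inDomain_comp (h : IsImage α z x) (hx : InDomain τ x) :
    InDomain (τ.comp α) z := by
  refine ⟨fun N => ?_, fun N => ?_⟩
  · obtain ⟨j, hj, hj'⟩ := hx.1 (blockStart α z N - 1)
    obtain ⟨n, h1, h2⟩ := h.1.exists_block j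
    refine ⟨n, ?_, h.ne_one_comp h1 h2 hj'⟩
    by_contra! hlt
    have := blockStart_mono α z hlt.le
    omega
  · obtain ⟨j, hj, hj'⟩ := hx.2 (blockStart α z N)
    obtain ⟨n, h1, h2⟩ := h.1.exists_block j
    refine ⟨n, ?_, h.ne_one_comp h1 h2 hj'⟩
    by_contra! hlt
    have := blockStart_mono α z (show n + 1 ≤ N by omega)
    omega

theorem IsImage.inDomain_of_comp (h : IsImage α z x) (hz : InDomain (τ.comp α) z) :
    InDomain τ x := by
  refine ⟨fun N => ?_, fun N => ?_⟩
  · obtain ⟨n, h1, h2⟩ := h.1.exists_block N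
    obtain ⟨m, hm, hm'⟩ := hz.1 (n - 1)
    obtain ⟨j, -, hj2, hj⟩ := h.exists_ne_one hm'
    have := blockStart_mono α z (show m + 1 ≤ n by omega)
    exact ⟨j, by omega, hj⟩
  · obtain ⟨n, h1, h2⟩ := h.1.exists_block N
    obtain ⟨m, hm, hm'⟩ := hz.2 (n + 1)
    obtain ⟨j, hj1, -, hj⟩ := h.exists_ne_one hm'
    have := blockStart_mono α z hm
    exact ⟨j, by omega, hj⟩

theorem IsImage.comp (h : IsImage α z x) (h' : IsImage τ x y) : IsImage (τ.comp α) z y := by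
  refine isImage_iff.2 ⟨h.inDomain_comp h'.1, fun n => ?_⟩
  rw [h.blockStart_comp, toList_comp]
  exact h'.occurs ((isImage_iff.1 h).2 n)

/-- A letter not erased by the composition is not erased by `α`, so α(z) exists; uniqueness of
images identifies its τ-image with `y`. -/
theorem IsImage.exists_of_comp (h : IsImage (τ.comp α) z y) :
    ∃ x, IsImage α z x ∧ IsImage τ x y := by
  have hne : ∀ a, (τ.comp α) (FreeMonoid.of a) ≠ 1 → α (FreeMonoid.of a) ≠ 1 := by
    intro a ha h0
    exact ha (by rw [MonoidHom.comp_apply, h0, map_one])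
  have hz : InDomain α z := ⟨fun N => (h.1.1 N).imp fun i hi => ⟨hi.1, hne _ hi.2⟩,
    fun N => (h.1.2 N).imp fun i hi => ⟨hi.1, hne _ hi.2⟩⟩
  obtain ⟨x, hx⟩ := hz.exists_image
  obtain ⟨y', hy'⟩ := (hx.inDomain_of_comp h.1).exists_image
  exact ⟨x, hx, (hx.comp hy').unique h ▸ hy'⟩

end Composition

end Image

/-! ### Tilings versus representations -/

section TilingsAndImages

variable {A B : Type*} {σ : FreeMonoid A →* FreeMonoid B}

/-- The words `σ(a)`, as lists. -/
def letterImage (σ : FreeMonoid A →* FreeMonoid B) (a : A) : List B :=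
  (σ (FreeMonoid.of a)).toList

theorem IsImage.exists_tiling {x : ℤ → A} {z : ℤ → B} (h : IsImage σ x z) (k : ℤ) :
    ∃ s, IsTiling (letterImage σ) (shift k z) s ∧ ∀ n i, blockStart σ x n ≤ i + k →
      i + k < blockStart σ x (n + 1) → s i = (x n, (i + k - blockStart σ x n).toNat) := by
  choose n h1 h2 using fun i => h.1.exists_block (i + k)
  have hs : ∀ m i, blockStart σ x m ≤ i + k → i + k < blockStart σ x (m + 1) →
      (x (n i), (i + k - blockStart σ x (n i)).toNat) =
        (x m, (i + k - blockStart σ x m).toNat) := by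
    intro m i hm hm'
    rw [block_unique (h1 i) (h2 i) hm hm']
  have hlen : ∀ i, blockStart σ x (n i + 1) =
      blockStart σ x (n i) + (letterImage σ (x (n i))).length := fun i => blockStart_succ _ _ _
  refine ⟨fun i => (x (n i), (i + k - blockStart σ x (n i)).toNat), ⟨fun i => ?_, fun i => ?_,
    fun i hi => ?_, fun i hi => ?_⟩, hs⟩
  · have := h1 i
    have := h2 i
    have := hlen i
    simp only
    omega
  · exact h.exists_getElem (h1 i) (h2 i)
  · simp only at hi
    have := h1 i
    have := hlen i
    rw [hs (n i) (i + 1) (by omega) (by omega)]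
    simp only [Prod.mk.injEq, true_and]
    omega
  · simp only at hi ⊢
    have e1 := h1 (i + 1)
    have e2 := h2 (i + 1)
    have e3 := h1 i
    have e4 := hlen i
    have : n i + 1 ≤ n (i + 1) := by
      by_contra! hlt
      have := blockStart_mono σ x (show n (i + 1) + 1 ≤ n i + 1 by omega)
      omega
    have := blockStart_mono σ x this
    omega

/-- A morphism whose images of letters are not products of words of a smaller set is recognizable
for aperiodic points. -/
theorem recognizableForAperiodic_of_not_factorsThrough [Finite A]
    (hf : ∀ k < Nat.card A, ¬ FactorsThrough (letterImage σ) k)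
    (hne : ∀ a, letterImage σ a ≠ []) : RecognizableForAperiodic σ Set.univ := by
  rintro y hy x - x' - k k' ⟨⟨z, hz, rfl⟩, hk0, hk⟩ ⟨⟨z', hz', e⟩, hk0', hk'⟩
  obtain ⟨s, hs, hsx⟩ := hz.exists_tiling k
  obtain ⟨s', hs', hsx'⟩ := hz'.exists_tiling k'
  rw [← e] at hs'
  obtain rfl := hs.eq_of_not_isPeriodic hf hne hy hs'
  have hlen : ∀ a, 1 ≤ (σ (FreeMonoid.of a)).length := fun a =>
    one_le_length fun h => hne a (by rw [letterImage, h]; rfl)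
  have b0 := blockStart_zero σ x
  have b0' := blockStart_zero σ x'
  have c0 := blockStart_succ σ x 0
  have c0' := blockStart_succ σ x' 0
  -- Centeredness puts position 0 in block 0 of both points, so the common tile there is both (x 0,
  -- k) and (x' 0, k'). From this block, equality spreads cut by cut.
  have e0 := (hsx 0 0 (by omega) (by omega)).symm.trans (hsx' 0 0 (by omega) (by omega))
  rw [Prod.mk.injEq] at e0
  obtain ⟨e0, e1⟩ := e0
  obtain rfl : k = k' := by omega
  refine ⟨?_, rfl⟩
  have key : ∀ n, blockStart σ x n = blockStart σ x' n ∧ x n = x' n := by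
    intro n
    induction n using Int.induction_on with
    | zero => exact ⟨by rw [b0, b0'], e0⟩
    | succ n ih =>
      have h1 : blockStart σ x (n + 1) = blockStart σ x' (n + 1) := by
        rw [blockStart_succ, blockStart_succ, ih.1, ih.2]
      refine ⟨h1, ?_⟩
      have l1 := hlen (x (n + 1))
      have l2 := hlen (x' (n + 1))
      have l3 := blockStart_succ σ x (n + 1)
      have l4 := blockStart_succ σ x' (n + 1)
      have := (hsx (n + 1) (blockStart σ x (n + 1) - k) (by omega) (by omega)).symm.trans
        (hsx' (n + 1) (blockStart σ x (n + 1) - k) (by omega) (by omega))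
      exact congrArg Prod.fst this
    | pred n ih =>
      have l1 := hlen (x (-n - 1))
      have l2 := hlen (x' (-n - 1))
      have l3 := blockStart_succ σ x (-n - 1)
      have l4 := blockStart_succ σ x' (-n - 1)
      rw [sub_add_cancel] at l3 l4
      have h1 := (hsx (-n - 1) (blockStart σ x (-n) - k - 1)
        (by omega) (by rw [sub_add_cancel]; omega)).symm.trans
        (hsx' (-n - 1) (blockStart σ x (-n) - k - 1) (by omega) (by rw [sub_add_cancel]; omega))
      have h1 : x (-n - 1) = x' (-n - 1) := congrArg Prod.fst h1
      refine ⟨?_, h1⟩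
      rw [h1] at l3
      have := ih.1
      omega
  exact funext fun n => (key n).2

theorem IsTiling.sub {C : Type*} {f : A → List C} {y : ℤ → C} {s : ℤ → A × ℕ}
    (h : IsTiling f y s) (q : ℤ) (j : ℕ) (hj : j ≤ (s q).2) :
    s (q - j) = ((s q).1, (s q).2 - j) := by
  induction j with
  | zero => simp
  | succ j ih =>
    have ih := ih (by omega)
    have e : q - j = q - (j + 1 : ℕ) + 1 := by push_cast; ring
    rcases h.next_or_last (q - (j + 1 : ℕ)) with h1 | h1
    · have h2 := h.next _ h1
      rw [← e, ih, Prod.mk.injEq] at h2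
      refine Prod.ext h2.1.symm ?_
      simp only
      omega
    · have h2 := h.last _ h1
      rw [← e, ih] at h2
      simp only at h2
      omega

/-- The word over letters and offsets that corresponds to a word over letters. -/
def expand {C : Type*} (f : A → List C) (w : List A) : List (A × ℕ) :=
  w.flatMap fun a => (List.range (f a).length).map (Prod.mk a)

/-- Keeping the letters at offset 0 undoes `expand`; this brings factor relations back from expanded
words. -/
theorem filterMap_expand {C : Type*} {f : A → List C} (hf : ∀ a, f a ≠ []) (w : List A) :
    (expand f w).filterMap (fun t => if t.2 = 0 then some t.1 else none) = w := by
  induction w with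
  | nil => rfl
  | cons a w ih =>
    rw [expand, List.flatMap_cons, List.filterMap_append]
    rw [expand] at ih
    rw [ih]
    obtain ⟨c, l, hcl⟩ := List.exists_cons_of_ne_nil (hf a)
    rw [hcl, List.length_cons, List.range_succ_eq_map, List.map_cons, List.filterMap_cons]
    simp only [if_true, List.map_map, List.filterMap_map]
    rw [List.filterMap_eq_nil_iff.2 (by simp)]
    rfl

/-- A decomposition into blocks gives a centered representation. -/
theorem IsTiling.exists_representation {y : ℤ → B} {s : ℤ → A × ℕ}
    (h : IsTiling (letterImage σ) y s) : ∃ x, IsCenteredRepresentation σ y x (s 0).2 ∧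
      ∀ i w, Occurs x i w → ∃ p, Occurs s p (expand (letterImage σ) w) := by
  set f := letterImage σ with hf
  let P : Type := {p : ℤ // (s p).2 = 0}
  have hpos : ∀ p, 0 < (f (s p).1).length := fun p => lt_of_le_of_lt (Nat.zero_le _) (h.lt p)
  have hnext : ∀ p, (s p).2 = 0 → (s (p + (f (s p).1).length)).2 = 0 := by
    intro p hp
    have := h.add_last p
    rwa [hp, Nat.sub_zero] at this
  have hinj : ∀ p q, (s p).2 = 0 → (s q).2 = 0 → p < q → q < p + (f (s p).1).length → False := by
    intro p q hp hq h1 h2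
    have := h.add p (q - p).toNat (by omega)
    rw [Int.toNat_of_nonneg (by omega), add_sub_cancel] at this
    rw [this] at hq
    simp only at hq
    omega
  -- Moving to the next cut permutes the cuts, so its integer powers, applied to the cut at or
  -- before 0, give the starting positions of the blocks.
  have hbij : Function.Bijective
      (fun p : P => (⟨p.1 + (f (s p.1).1).length, hnext p.1 p.2⟩ : P)) := by
    constructor
    · rintro ⟨p, hp⟩ ⟨q, hq⟩ hpq
      have hpq : p + (f (s p).1).length = q + (f (s q).1).length := congrArg Subtype.val hpq
      refine Subtype.ext ?_
      have := hpos p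
      have := hpos q
      rcases lt_trichotomy p q with hlt | heq | hlt
      · exact (hinj p q hp hq hlt (by omega)).elim
      · exact heq
      · exact (hinj q p hq hp hlt (by omega)).elim
    · rintro ⟨q, hq⟩
      have e := h.sub (q - 1) (s (q - 1)).2 le_rfl
      rw [Nat.sub_self] at e
      refine ⟨⟨q - 1 - (s (q - 1)).2, by rw [e]⟩, Subtype.ext ?_⟩
      simp only [e]
      rcases h.next_or_last (q - 1) with h1 | h1
      · have := h.next _ h1
        rw [sub_add_cancel] at this
        rw [this] at hq
        simp at hq
      · omega
  let e : Equiv.Perm P := Equiv.ofBijective _ hbij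
  have hstart : (s (-(s 0).2)).2 = 0 := by
    have := h.sub 0 (s 0).2 le_rfl
    rw [zero_sub] at this
    rw [this, Nat.sub_self]
  have hstart' : (s (-(s 0).2)).1 = (s 0).1 := by
    have := h.sub 0 (s 0).2 le_rfl
    rw [zero_sub] at this
    rw [this]
  let c : ℤ → ℤ := fun n => ((e ^ n) (⟨-(s 0).2, hstart⟩ : P)).1
  have hc : ∀ n, (s (c n)).2 = 0 := fun n => ((e ^ n) (⟨-(s 0).2, hstart⟩ : P)).2
  have hc0 : c 0 = -(s 0).2 := by simp [c]
  have hc1 : ∀ n, c (n + 1) = c n + (f (s (c n)).1).length := by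
    intro n
    simp only [c]
    rw [add_comm n 1, zpow_add, zpow_one, Equiv.Perm.mul_apply]
    rfl
  let x : ℤ → A := fun n => (s (c n)).1
  have hbs : ∀ n, c n - c 0 = blockStart σ x n := by
    refine eq_blockStart σ x (g := fun n => c n - c 0) (sub_self _) fun n => ?_
    simp only [hc1]
    change _ = _ + ((f (s (c n)).1).length : ℤ)
    ring
  have hne : ∀ n, σ (FreeMonoid.of (x n)) ≠ 1 := by
    intro n h0
    have := hpos (c n)
    have h1 : f (x n) = [] := by rw [hf, letterImage, h0]; rfl
    change 0 < (f (x n)).length at this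
    rw [h1] at this
    exact absurd this (by simp)
  refine ⟨x, ⟨⟨shift (c 0) y, isImage_iff.2 ⟨⟨fun N => ⟨N, le_rfl, hne N⟩,
    fun N => ⟨N, le_rfl, hne N⟩⟩, fun n => ?_⟩, ?_⟩, by omega, ?_⟩, ?_⟩
  · rw [occurs_shift, ← hbs, sub_add_cancel]
    exact h.occurs_zero (hc n)
  · rw [shift_shift, hc0, add_neg_cancel, shift_zero]
  · change ((s 0).2 : ℤ) < ((f (s (c 0)).1).length : ℤ)
    rw [hc0, hstart']
    exact_mod_cast h.lt 0
  · intro i w hw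
    refine ⟨c i, ?_⟩
    induction w generalizing i with
    | nil => exact occurs_nil _ _
    | cons a w ih =>
      rw [← List.singleton_append, occurs_append] at hw
      have h0 : x i = a := by simpa using hw.1 0 (by simp)
      have h1 := ih (i + 1) hw.2
      rw [expand, List.flatMap_cons, occurs_append]
      constructor
      · intro j hj
        have hj' : j < (f a).length := by simpa using hj
        have h0' : (s (c i)).1 = a := h0
        have := h.add (c i) j (by rw [hc, h0', zero_add]; exact hj')
        rw [this, hc, h0']
        simp
      · rw [hc1] at h1
        have h0' : (s (c i)).1 = a := h0
        rw [h0'] at h1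
        rw [List.length_map, List.length_range]
        exact h1

end TilingsAndImages

/-! ### Compactness: from finite factors to a tiling -/

section Compactness

variable {A C : Type*} {f : A → List C}

theorem expand_cons (a : A) (w : List A) : expand f (a :: w) =
    (List.range (f a).length).map (Prod.mk a) ++ expand f w := rfl

theorem map_expand (f : A → List C) (w : List A) :
    (expand f w).map (fun t => (f t.1)[t.2]?) = (w.flatMap f).map some := by
  induction w with
  | nil => rfl
  | cons a w ih =>
    rw [expand_cons, List.map_append, ih, List.flatMap_cons, List.map_append]
    congr 1
    refine List.ext_getElem (by simp) fun n h1 h2 => ?_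
    simp at h1 ⊢

theorem lt_of_mem_expand {w : List A} {t : A × ℕ} (h : t ∈ expand f w) :
    t.2 < (f t.1).length := by
  simp only [expand, List.mem_flatMap, List.mem_map, List.mem_range] at h
  obtain ⟨a, -, j, hj, rfl⟩ := h
  exact hj

/-- The tiling rules concern two consecutive positions, hence pass to limits of words. The condition
on the head makes the induction work at block junctions. -/
theorem isChain_expand (f : A → List C) (w : List A) :
    (expand f w).IsChain (fun t t' => (t.2 + 1 < (f t.1).length → t' = (t.1, t.2 + 1)) ∧
      (t.2 + 1 = (f t.1).length → t'.2 = 0)) ∧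
    ∀ t ∈ (expand f w).head?, t.2 = 0 := by
  induction w with
  | nil => simp [expand]
  | cons a w ih =>
    rw [expand_cons]
    refine ⟨?_, ?_⟩
    · rw [List.isChain_append]
      refine ⟨?_, ih.1, ?_⟩
      · rw [List.isChain_iff_getElem]
        intro i hi
        simp at hi ⊢
        omega
      · intro t ht t' ht'
        have h0 := ih.2 t' ht'
        refine ⟨fun h1 => ?_, fun _ => h0⟩
        exfalso
        rw [Option.mem_def, List.getLast?_eq_getElem?] at ht
        simp at ht
        obtain ⟨b, hb, rfl⟩ := ht
        rw [List.getElem?_range (by have := List.getElem?_eq_some_iff.1 hb; simp at this; omega)] at hb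
        simp at hb h1
        omega
    · intro t ht
      cases hfa : (f a) with
      | nil =>
        rw [hfa] at ht
        exact ih.2 t ht
      | cons c l =>
        rw [hfa, List.length_cons, List.range_succ_eq_map] at ht
        simp at ht
        rw [← ht]

/-- If all words that occur in `y` are factors of products of blocks `f a` along words of `W`, then
`y` decomposes into blocks, along words that are factors of words of `W`. -/
theorem exists_tiling_of_infix [Finite A] {y : ℤ → C} {W : Set (List A)}
    (hy : ∀ p l, Occurs y p l → ∃ w ∈ W, l <:+: w.flatMap f) :
    ∃ s, IsTiling f y s ∧ ∀ p l, Occurs s p l → ∃ w ∈ W, l <:+: expand f w := by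
  have hlist : ∀ k : ℕ, ∃ l : List (A × ℕ), (∃ w ∈ W, l <:+: expand f w) ∧ l.length = 2 * k ∧
      ∀ j : ℕ, ∀ hj : j < l.length, (f l[j].1)[l[j].2]? = some (y (-k + j)) := by
    intro k
    obtain ⟨w, hw, hl⟩ := hy (-k) ((List.range (2 * k)).map fun j : ℕ => y (-k + j))
      (fun j hj => by simp)
    have h1 := hl.map some
    rw [← map_expand, List.infix_map_iff] at h1
    obtain ⟨l, hl1, hl2⟩ := h1
    have hlen : l.length = 2 * k := by simpa using (congrArg List.length hl2).symm
    refine ⟨l, ⟨w, hw, hl1⟩, hlen, fun j hj => ?_⟩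
    have h3 := congrArg (fun l => l[j]?) hl2
    simp only [List.getElem?_map] at h3
    rw [List.getElem?_eq_getElem hj, List.getElem?_range (by omega)] at h3
    simpa using h3.symm
  choose l hl hlen hval using hlist
  obtain ⟨a₀⟩ : Nonempty A := by
    have : 0 < (l 1).length := by rw [hlen]; norm_num
    exact ⟨(l 1)[0].1⟩
  -- The default value is only taken outside of the window [-k, k).
  let S : ℕ → ℤ → A × ℕ := fun k i => (l k).getD (i + k).toNat (a₀, 0)
  have hS : ∀ k : ℕ, ∀ i : ℤ, -k ≤ i → i < k → ∃ h : (i + k).toNat < (l k).length,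
      S k i = (l k)[(i + k).toNat] := by
    intro k i h1 h2
    have hk := hlen k
    have h : (i + k).toNat < (l k).length := by omega
    exact ⟨h, List.getD_eq_getElem _ _ h⟩
  have hwin : ∀ k : ℕ, ∀ p : ℤ, ∀ u, Occurs (S k) p u → -k ≤ p → p + u.length ≤ k →
      u <:+: l k := by
    intro k p u hu h1 h2
    have hk := hlen k
    have : u = ((l k).drop (p + k).toNat).take u.length := by
      refine List.ext_getElem (by simp; omega) fun n hn hn' => ?_
      obtain ⟨h, e⟩ := hS k (p + n) (by omega) (by omega)
      rw [← hu n hn, e]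
      simp only [List.getElem_take, List.getElem_drop]
      congr 1
      omega
    rw [this]
    exact (List.take_prefix _ _).isInfix.trans (List.drop_suffix _ _).isInfix
  let F : Set (A × ℕ) := {t | t.2 < (f t.1).length}
  have hF : F.Finite := by
    refine ((Set.finite_univ (α := A)).biUnion fun a _ =>
      (Set.finite_Iio (f a).length).image (Prod.mk a)).subset ?_
    rintro t ht
    simp only [Set.mem_iUnion]
    exact ⟨t.1, Set.mem_univ _, t.2, ht, rfl⟩
  have hlarge : ∀ n : ℕ, ∀ᶠ k : ℕ in (hyperfilter ℕ : Filter ℕ), n ≤ k := fun n =>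
    Nat.hyperfilter_le_atTop (eventually_ge_atTop n)
  have hlim : ∀ i : ℤ, ∃ t ∈ F, ∀ᶠ k in (hyperfilter ℕ : Filter ℕ), S k i = t := by
    intro i
    -- Each position takes finitely many values, so the tiled windows converge pointwise along a
    -- nonprincipal ultrafilter.
    refine (Ultrafilter.eventually_exists_mem_iff hF).1 ?_
    filter_upwards [hlarge (i.natAbs + 1)] with k hk
    obtain ⟨h, e⟩ := hS k i (by omega) (by omega)
    obtain ⟨w, -, hw⟩ := hl k
    exact ⟨_, lt_of_mem_expand (hw.subset (List.getElem_mem h)), e⟩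
  choose s hsF hs using hlim
  have hocc : ∀ p u, Occurs s p u → ∃ w ∈ W, u <:+: expand f w := by
    intro p u hu
    have h1 : ∀ᶠ k in (hyperfilter ℕ : Filter ℕ), ∀ j : Fin u.length, S k (p + j) = s (p + j) :=
      eventually_all.2 fun j => hs _
    obtain ⟨k, hk, hk'⟩ := (h1.and (hlarge (p.natAbs + u.length))).exists
    obtain ⟨w, hw, hw'⟩ := hl k
    refine ⟨w, hw, (hwin k p u (fun j hj => ?_) (by omega) (by omega)).trans hw'⟩
    rw [hk ⟨j, hj⟩, hu j hj]
  have hstep : ∀ i, ((s i).2 + 1 < (f (s i).1).length → s (i + 1) = ((s i).1, (s i).2 + 1)) ∧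
      ((s i).2 + 1 = (f (s i).1).length → (s (i + 1)).2 = 0) := by
    intro i
    obtain ⟨w, -, hw⟩ := hocc i [s i, s (i + 1)] (by
      intro j hj
      have : j = 0 ∨ j = 1 := by simp at hj; omega
      rcases this with rfl | rfl <;> simp)
    have := (isChain_expand f w).1.infix hw
    simpa using this
  refine ⟨s, ⟨hsF, fun i => ?_, fun i => (hstep i).1, fun i => (hstep i).2⟩, hocc⟩
  obtain ⟨k, hk, hk'⟩ := ((hs i).and (hlarge (i.natAbs + 1))).exists
  obtain ⟨h, e⟩ := hS k i (by omega) (by omega)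
  have := hval k _ h
  rw [← e, hk] at this
  rw [this]
  congr 2
  omega

end Compactness

/-! ### Rank of a morphism -/

section Rank

variable {A B C : Type*}

theorem factorsThrough_iff {φ : FreeMonoid A →* FreeMonoid B} {k : ℕ} :
    FactorsThrough (letterImage φ) k ↔ ∃ (α : FreeMonoid (Fin k) →* FreeMonoid B)
      (β : FreeMonoid A →* FreeMonoid (Fin k)), φ = α.comp β := by
  constructor
  · rintro ⟨α, β, h⟩
    refine ⟨FreeMonoid.lift fun b => FreeMonoid.ofList (α b),
      FreeMonoid.lift fun a => FreeMonoid.ofList (β a), FreeMonoid.hom_eq fun a => ?_⟩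
    apply FreeMonoid.toList.injective
    rw [MonoidHom.comp_apply, FreeMonoid.lift_eval_of, toList_map]
    exact (h a).trans (by simp)
  · rintro ⟨α, β, rfl⟩
    exact ⟨letterImage α, letterImage β, fun a => toList_comp α β a⟩

theorem factorsThrough_card [Finite A] (f : A → List C) : FactorsThrough f (Nat.card A) :=
  FactorsThrough.of_finite f (fun a => [a]) fun a => by simp

/-- The least size of a set of words of which all words `φ(a)` are products. -/
noncomputable def rank (φ : FreeMonoid A →* FreeMonoid B) : ℕ :=
  sInf {k | FactorsThrough (letterImage φ) k}

theorem rank_le {φ : FreeMonoid A →* FreeMonoid B} {k : ℕ}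
    (h : FactorsThrough (letterImage φ) k) : rank φ ≤ k := Nat.sInf_le h

theorem rank_le_card [Finite A] (φ : FreeMonoid A →* FreeMonoid B) : rank φ ≤ Nat.card A :=
  rank_le (factorsThrough_card _)

theorem factorsThrough_rank [Finite A] (φ : FreeMonoid A →* FreeMonoid B) :
    FactorsThrough (letterImage φ) (rank φ) :=
  Nat.sInf_mem (s := {k | FactorsThrough (letterImage φ) k}) ⟨_, factorsThrough_card _⟩

theorem FactorsThrough.comp_right {φ : FreeMonoid B →* FreeMonoid C} {k : ℕ}
    (h : FactorsThrough (letterImage φ) k) (ψ : FreeMonoid A →* FreeMonoid B) :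
    FactorsThrough (letterImage (φ.comp ψ)) k := by
  obtain ⟨α, β, rfl⟩ := factorsThrough_iff.1 h
  exact factorsThrough_iff.2 ⟨α, β.comp ψ, rfl⟩

theorem FactorsThrough.comp_left {φ : FreeMonoid A →* FreeMonoid B} {k : ℕ}
    (h : FactorsThrough (letterImage φ) k) (ψ : FreeMonoid B →* FreeMonoid C) :
    FactorsThrough (letterImage (ψ.comp φ)) k := by
  obtain ⟨α, β, rfl⟩ := factorsThrough_iff.1 h
  exact factorsThrough_iff.2 ⟨ψ.comp α, β, rfl⟩

/-- A letter with empty image could be dropped from the alphabet. -/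
theorem letterImage_ne_nil [Finite A] {f : A → List C}
    (hf : ∀ k < Nat.card A, ¬ FactorsThrough f k) (a : A) : f a ≠ [] := by
  classical
  intro ha
  refine hf _ (Finite.card_subtype_lt (p := fun b => b ≠ a) (x := a) (by simp))
    (FactorsThrough.of_finite (fun b => f b) (fun c => if h : c = a then [] else [⟨c, h⟩]) ?_)
  intro c
  by_cases h : c = a
  · simp [h, ha]
  · simp [h]

/-- A morphism factors through an alphabet whose size is its rank, with a left factor that does not
factor through a smaller alphabet. -/
theorem exists_factorization_rank [Finite A] (φ : FreeMonoid A →* FreeMonoid B) :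
    ∃ (ρ : ℕ) (α : FreeMonoid (Fin ρ) →* FreeMonoid B) (β : FreeMonoid A →* FreeMonoid (Fin ρ)),
      rank φ = ρ ∧ φ = α.comp β ∧ ∀ k < ρ, ¬ FactorsThrough (letterImage α) k := by
  obtain ⟨α, β, h⟩ := factorsThrough_iff.1 (factorsThrough_rank φ)
  refine ⟨rank φ, α, β, rfl, h, fun k hk hα => ?_⟩
  have := rank_le (φ := φ) (by rw [h]; exact hα.comp_right β)
  omega

theorem IsPeriodic.map_shift {y : ℤ → A} (h : IsPeriodic y) (k : ℤ) :
    IsPeriodic (shift k y) := by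
  obtain ⟨n, hn, e⟩ := h
  exact ⟨n, hn, by rw [shift_shift, add_comm, ← shift_shift, e]⟩

/-- The intermediate point is constant, hence fixed by the shift, and its image is fixed by the
shift by the length of one block, which is positive because the image is defined. -/
theorem IsImage.isPeriodic {φ : FreeMonoid A →* FreeMonoid B} {k : ℕ} (hk : k ≤ 1)
    (hφ : FactorsThrough (letterImage φ) k) {z : ℤ → A} {y : ℤ → B} (h : IsImage φ z y) :
    IsPeriodic y := by
  obtain ⟨γ, δ, rfl⟩ := factorsThrough_iff.1 hφ
  obtain ⟨w, -, hw⟩ := h.exists_of_comp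
  have : Subsingleton (Fin k) := Fin.subsingleton_iff_le_one.2 hk
  obtain ⟨i, -, hi⟩ := hw.1.1 0
  rw [Subsingleton.elim (w i) (w 0)] at hi
  have hbs := blockStart_succ γ w 0
  rw [blockStart_zero, zero_add, zero_add] at hbs
  have h1 := hw.map_shift 1
  rw [hbs, Subsingleton.elim (shift 1 w) w] at h1
  exact ⟨_, one_le_length hi, h1.unique hw⟩

end Rank

/-! ### Composing centered representations; factors of words -/

section Composition

variable {A B C : Type*} {α : FreeMonoid A →* FreeMonoid B} {τ : FreeMonoid B →* FreeMonoid C}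

/-- The bound on `k` says that the new offset falls in block `l` of τ(x₁); `l` and `k` can thus be
recovered from it. -/
theorem IsCenteredRepresentation.comp {x : ℤ → B} {y : ℤ → C} {z : ℤ → A} {l k : ℤ}
    (hx : IsCenteredRepresentation α x z l) (hy : IsCenteredRepresentation τ y x k) :
    ∃ x₁, IsImage α z x₁ ∧ x = shift l x₁ ∧ k < blockStart τ x₁ (l + 1) - blockStart τ x₁ l ∧
      IsCenteredRepresentation (τ.comp α) y z (k + blockStart τ x₁ l) := by
  obtain ⟨⟨x₁, hx₁, rfl⟩, hl0, hl⟩ := hx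
  obtain ⟨⟨y₁, hy₁, rfl⟩, hk0, hk⟩ := hy
  have h1 := hy₁.map_shift (-l)
  rw [shift_shift, neg_add_cancel, shift_zero, blockStart_shift, neg_add_cancel, blockStart_zero,
    zero_sub] at h1
  have h2 : k < blockStart τ x₁ (l + 1) - blockStart τ x₁ l := by
    rw [blockStart_succ]
    rw [shift, zero_add] at hk
    omega
  have h3 := blockStart_succ α z 0
  have h4 := blockStart_succ (τ.comp α) z 0
  rw [blockStart_zero, zero_add, zero_add] at h3 h4
  refine ⟨x₁, hx₁, rfl, h2, ⟨_, hx₁.comp h1, ?_⟩, ?_, ?_⟩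
  · rw [shift_shift, add_neg_cancel_right]
  · have := blockStart_mono τ x₁ hl0
    rw [blockStart_zero] at this
    omega
  · have := blockStart_mono τ x₁ (show l + 1 ≤ blockStart α z 1 by omega)
    rw [← hx₁.blockStart_comp] at this
    omega

theorem Occurs.infix {x : ℤ → A} {p q : ℤ} {u w : List A} (hu : Occurs x q u) (hw : Occurs x p w)
    (h1 : p ≤ q) (h2 : q + u.length ≤ p + w.length) : u <:+: w := by
  have : u = (w.drop (q - p).toNat).take u.length := by
    refine List.ext_getElem (by simp; omega) fun n hn hn' => ?_
    rw [← hu n hn]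
    simp only [List.getElem_take, List.getElem_drop]
    rw [← hw _ (by omega)]
    congr 1
    omega
  rw [this]
  exact (List.take_prefix _ _).isInfix.trans (List.drop_suffix _ _).isInfix

theorem isFactor_iff {u w : FreeMonoid A} : IsFactor u w ↔ u.toList <:+: w.toList := by
  constructor
  · rintro ⟨r, t, rfl⟩
    exact ⟨r.toList, t.toList, by simp⟩
  · rintro ⟨r, t, h⟩
    refine ⟨FreeMonoid.ofList r, FreeMonoid.ofList t, FreeMonoid.toList.injective ?_⟩
    simpa using h.symm

theorem IsFactor.map (σ : FreeMonoid A →* FreeMonoid B) {u w : FreeMonoid A} (h : IsFactor u w) :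
    IsFactor (σ u) (σ w) := by
  obtain ⟨r, t, rfl⟩ := h
  exact ⟨σ r, σ t, by rw [map_mul, map_mul]⟩

theorem IsFactor.trans {u v w : FreeMonoid A} (h : IsFactor u v) (h' : IsFactor v w) :
    IsFactor u w :=
  isFactor_iff.2 ((isFactor_iff.1 h).trans (isFactor_iff.1 h'))

end Composition

/-! ### Rank and the two properties at a given level -/

section Sequences

variable {A : ℕ → Type*} (σ : ∀ n, FreeMonoid (A (n + 1)) →* FreeMonoid (A n))

/-- The composition `σ_{[n, m)}`. -/
def iter (n m : ℕ) (h : n ≤ m) : FreeMonoid (A m) →* FreeMonoid (A n) :=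
  Nat.leRec (motive := fun m _ => FreeMonoid (A m) →* FreeMonoid (A n))
    (MonoidHom.id _) (fun k _ g => g.comp (σ k)) h

theorem iter_self (n : ℕ) : iter σ n n le_rfl = MonoidHom.id _ := Nat.leRec_self _ _

theorem iter_succ (n m : ℕ) (h : n ≤ m) (h' : n ≤ m + 1) :
    iter σ n (m + 1) h' = (iter σ n m h).comp (σ m) := Nat.leRec_succ _ _ _

theorem comp_eq_iter (n k : ℕ) : comp σ n k = iter σ n (n + k) (Nat.le_add_right n k) := by
  induction k with
  | zero => exact (iter_self σ n).symm
  | succ k ih =>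
    rw [comp, ih]
    exact (iter_succ σ n (n + k) _ _).symm

theorem iter_trans {n m p : ℕ} (h : n ≤ m) (h' : m ≤ p) :
    iter σ n p (h.trans h') = (iter σ n m h).comp (iter σ m p h') := by
  induction p, h' using Nat.le_induction with
  | base => rw [iter_self, MonoidHom.comp_id]
  | succ p hp ih => rw [iter_succ σ n p (h.trans hp), ih, iter_succ σ m p hp, MonoidHom.comp_assoc]

theorem iter_left {n m : ℕ} (h : n + 1 ≤ m) :
    iter σ n m ((Nat.le_succ n).trans h) = (σ n).comp (iter σ (n + 1) m h) := by
  rw [iter_trans σ (Nat.le_succ n) h, iter_succ σ n n le_rfl, iter_self, MonoidHom.id_comp]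

theorem mem_language_iff {n : ℕ} {w : FreeMonoid (A n)} : w ∈ language σ n ↔
    ∃ (m : ℕ) (h : n ≤ m) (a : A m), IsFactor w (iter σ n m h (FreeMonoid.of a)) := by
  constructor
  · rintro ⟨k, a, h⟩
    exact ⟨n + k, Nat.le_add_right n k, a, by rwa [← comp_eq_iter]⟩
  · rintro ⟨m, h, a, hw⟩
    obtain ⟨k, rfl⟩ := Nat.exists_eq_add_of_le h
    exact ⟨k, a, by rwa [comp_eq_iter]⟩

variable [∀ n, Finite (A n)]

/-- The images of letters of the finitely many levels below `m` have bounded length. Extending `l`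
to a window of `y` longer than this bound `L` forces a level at least `m`. -/
theorem exists_infix_iter {n m : ℕ} {y : ℤ → A n} (hy : y ∈ shiftSpace σ n)
    {p : ℤ} {l : List (A n)} (hl : Occurs y p l) : ∃ (m' : ℕ) (h : n ≤ m') (_ : m ≤ m') (a : A m'),
      l <:+: (iter σ n m' h (FreeMonoid.of a)).toList := by
  obtain ⟨L, hL⟩ := (Set.finite_range fun t : (Σ i : {i : Fin m // n ≤ i}, A i.1) =>
    (iter σ n t.1.1 t.1.2 (FreeMonoid.of t.2)).length).bddAbove
  obtain ⟨m', h, a, hw⟩ := (mem_language_iff σ).1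
    (hy p (p + l.length + L + 1) (by omega))
  rw [isFactor_iff] at hw
  have hlen := length_word y p (p + l.length + L + 1)
  have hlen' : (word y p (p + l.length + L + 1)).toList.length = l.length + L + 1 := by
    change (word y p (p + l.length + L + 1)).length = _
    omega
  refine ⟨m', h, ?_, a, (hl.infix (occurs_word _ _ _) le_rfl (by omega)).trans hw⟩
  by_contra! hlt
  have h1 : (iter σ n m' h (FreeMonoid.of a)).length ≤ L := hL ⟨⟨⟨⟨m', hlt⟩, h⟩, a⟩, rfl⟩
  have h2 := hw.length_le
  change _ ≤ (iter σ n m' h (FreeMonoid.of a)).length at h2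
  omega

/-- Points of the shift space are images under left factors of the compositions. -/
theorem exists_centeredRepresentation {n m : ℕ} (h : n ≤ m) {D : Type*} [Finite D]
    {φ : FreeMonoid D →* FreeMonoid (A n)} {β : FreeMonoid (A m) →* FreeMonoid D}
    (hφ : iter σ n m h = φ.comp β) (hne : ∀ d, letterImage φ d ≠ [])
    {y : ℤ → A n} (hy : y ∈ shiftSpace σ n) : ∃ z k, IsCenteredRepresentation φ y z k ∧
      ∀ i u, Occurs z i u → ∃ (m' : ℕ) (h' : m ≤ m') (a : A m'),
        u <:+: (β (iter σ m m' h' (FreeMonoid.of a))).toList := by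
  obtain ⟨s, hs, hs'⟩ := exists_tiling_of_infix (f := letterImage φ) (y := y)
    (W := {w | ∃ (m' : ℕ) (h' : m ≤ m') (a : A m'),
      w = (β (iter σ m m' h' (FreeMonoid.of a))).toList}) (by
    intro p l hl
    obtain ⟨m', h1, h2, a, hla⟩ := exists_infix_iter σ (m := m) hy hl
    refine ⟨_, ⟨m', h2, a, rfl⟩, ?_⟩
    rw [iter_trans σ h h2, hφ] at hla
    change _ <:+: List.flatMap (fun d => (φ (FreeMonoid.of d)).toList) _
    rw [← toList_map]
    exact hla)
  obtain ⟨z, hz, hz'⟩ := hs.exists_representation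
  refine ⟨z, _, hz, fun i u hu => ?_⟩
  obtain ⟨p, hp⟩ := hz' i u hu
  obtain ⟨_, ⟨m', h', a, rfl⟩, hw⟩ := hs' p _ hp
  have := hw.filterMap (fun t => if t.2 = 0 then some t.1 else none)
  rw [filterMap_expand hne, filterMap_expand hne] at this
  exact ⟨m', h', a, this⟩

/-- Both representations lift along `α` to centered (σ_i ∘ α)-representations of the same aperiodic
point, and these coincide once σ_i ∘ α is elementary. -/
theorem recognizableForAperiodicAt_of_rank {i m : ℕ} (h : i + 1 ≤ m)
    (hr : rank (iter σ i m ((Nat.le_succ i).trans h)) = rank (iter σ (i + 1) m h) ∨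
      rank (iter σ (i + 1) m h) ≤ 2) : RecognizableForAperiodicAt σ i := by
  obtain ⟨ρ, α, β, hρ, hαβ, hα⟩ := exists_factorization_rank (iter σ (i + 1) m h)
  have hα' : ∀ b, letterImage α b ≠ [] := letterImage_ne_nil (by rwa [Nat.card_fin])
  intro y hy x hx x' hx' k k' hk hk'
  obtain ⟨z, l, hz, -⟩ := exists_centeredRepresentation σ h hαβ hα' hx
  obtain ⟨z', l', hz', -⟩ := exists_centeredRepresentation σ h hαβ hα' hx'
  obtain ⟨x₁, h1, rfl, h2, h3⟩ := hz.comp hk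
  obtain ⟨x₁', h1', rfl, h2', h3'⟩ := hz'.comp hk'
  have hφ : ∀ k < ρ, ¬ FactorsThrough (letterImage ((σ i).comp α)) k := by
    intro j hj hj'
    -- Without a jump, a smaller factorization contradicts the rank of σ_[i,m). With ρ ≤ 2, it
    -- passes through at most one letter and `y` would be periodic.
    rcases hr with hr | hr
    · have := hj'.comp_right β
      rw [MonoidHom.comp_assoc, ← hαβ, ← iter_left] at this
      have := rank_le this
      omega
    · obtain ⟨⟨y₁, hy₁, rfl⟩, -⟩ := h3
      exact hy ((hy₁.isPeriodic (by omega) hj').map_shift _)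
  have hφ' : ∀ k < Nat.card (Fin ρ), ¬ FactorsThrough (letterImage ((σ i).comp α)) k := by
    rwa [Nat.card_fin]
  obtain ⟨rfl, e⟩ := recognizableForAperiodic_of_not_factorsThrough hφ' (letterImage_ne_nil hφ')
    y hy z (Set.mem_univ _) z' (Set.mem_univ _) _ _ h3 h3'
  obtain rfl := h1.unique h1'
  have hk0 := hk.2.1
  have hk0' := hk'.2.1
  obtain rfl : l = l' := block_unique (σ := σ i) (x := x₁) (i := k + blockStart (σ i) x₁ l)
    (by omega) (by omega) (by omega) (by omega)
  exact ⟨rfl, by omega⟩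

/-- The point α(z) for a (σ_i ∘ α)-representation z of `y` lies in the shift space of level i + 1,
since factors of z are factors of words β(σ_[m,m')(a)) and α ∘ β = σ_[i+1,m). -/
theorem representableAt_of_rank {i m : ℕ} (h : i + 1 ≤ m)
    (hr : rank (iter σ i m ((Nat.le_succ i).trans h)) = rank (iter σ (i + 1) m h)) :
    RepresentableAt σ i := by
  obtain ⟨ρ, α, β, hρ, hαβ, -⟩ := exists_factorization_rank (iter σ (i + 1) m h)
  have hcomp : iter σ i m ((Nat.le_succ i).trans h) = ((σ i).comp α).comp β := by
    rw [iter_left σ h, hαβ, MonoidHom.comp_assoc]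
  have hφ : ∀ k < Nat.card (Fin ρ), ¬ FactorsThrough (letterImage ((σ i).comp α)) k := by
    intro j hj hj'
    rw [Nat.card_fin] at hj
    have := hj'.comp_right β
    rw [← hcomp] at this
    have := rank_le this
    omega
  intro y hy
  obtain ⟨z, k, ⟨⟨y₁, hy₁, rfl⟩, -⟩, hz⟩ :=
    exists_centeredRepresentation σ ((Nat.le_succ i).trans h) hcomp (letterImage_ne_nil hφ) hy
  obtain ⟨x, hx, hx'⟩ := hy₁.exists_of_comp
  refine ⟨x, fun a b hab => ?_, k, y₁, hx', rfl⟩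
  obtain ⟨n, hn, -⟩ := hx.1.exists_block a
  obtain ⟨n', -, hn'⟩ := hx.1.exists_block b
  -- The blocks of z with index in [n, c) cover the window [a, b); the maximum makes n ≤ c
  -- immediate.
  set c := max n (n' + 1) with hc
  have hb := blockStart_mono α z (show n' + 1 ≤ c from le_max_right _ _)
  have hnc : n ≤ c := le_max_left _ _
  have hu := occurs_word z n c
  obtain ⟨m', h', t, ht⟩ := hz n _ hu
  have hlen : ((word z n c).toList.length : ℤ) = c - n := by
    have := length_word z n c
    change ((word z n c).length : ℤ) = _
    omega
  have hlen2 := blockStart_add_length (σ := α) hu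
  rw [hlen, add_sub_cancel] at hlen2
  have hw : IsFactor (word x a b) (α (word z n c)) := by
    have e : (α (word z n c)).toList =
        (word z n c).toList.flatMap fun d => (α (FreeMonoid.of d)).toList := toList_map α _
    rw [isFactor_iff, e]
    refine (occurs_word x a b).infix (hx.occurs hu) hn ?_
    have : ((word x a b).toList.length : ℤ) = b - a := by
      have := length_word x a b
      change ((word x a b).length : ℤ) = _
      omega
    omega
  refine (mem_language_iff σ).2 ⟨m', h.trans h', t, hw.trans ?_⟩
  rw [iter_trans σ h h', hαβ]
  exact (isFactor_iff.2 ht).map α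

/-- Rank 0 means that σ_[i,m) erases everything, so the shift space of level `i` is empty. -/
theorem representableAt_of_rank_eq_zero {i m : ℕ} (h : i ≤ m) (hr : rank (iter σ i m h) = 0) :
    RepresentableAt σ i := by
  intro y hy
  exfalso
  have h0 := factorsThrough_rank (iter σ i m h)
  rw [hr] at h0
  obtain ⟨α, β, hαβ⟩ := factorsThrough_iff.1 h0
  obtain ⟨m', h1, h2, a, ha⟩ := exists_infix_iter σ (m := m) hy (p := 0) (l := [y 0])
    (fun j hj => by
      obtain rfl : j = 0 := by simpa using hj
      simp)
  rw [iter_trans σ h h2, hαβ, MonoidHom.comp_apply, MonoidHom.comp_apply] at ha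
  have hnil : β (iter σ m m' h2 (FreeMonoid.of a)) = 1 :=
    FreeMonoid.toList.injective (List.eq_nil_iff_forall_not_mem.2 fun b => b.elim0)
  rw [hnil, map_one] at ha
  exact absurd ha.length_le (by simp)

/-- The rank of `σ_{[n, m)}` does not decrease with `n`. -/
theorem rank_iter_le {i m : ℕ} (h : i + 1 ≤ m) :
    rank (iter σ i m ((Nat.le_succ i).trans h)) ≤ rank (iter σ (i + 1) m h) := by
  refine rank_le ?_
  rw [iter_left]
  exact (factorsThrough_rank _).comp_left _

end Sequences

/-! ### Counting the jumps -/

/-- A set of levels at which a bounded monotone function jumps is finite. -/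
theorem encard_le_of_jumps {N : Set ℕ} {c r : ℕ} (H : ∀ M : ℕ, ∃ m ≥ M, ∃ g : ℕ → ℕ,
    (∀ i < m, g i ≤ g (i + 1)) ∧ g m ≤ r ∧ ∀ i ∈ N, i < m → g i < g (i + 1) ∧ c ≤ g (i + 1)) :
    N.encard ≤ ((r + 1 - c : ℕ) : ℕ∞) := by
  by_contra! hlt
  -- One level too many is selected and `m` is taken beyond all of them; then i ↦ g (i + 1) is
  -- injective on `t` with values in [c, r].
  obtain ⟨t, htN, ht⟩ := Set.exists_subset_encard_eq (Order.add_one_le_of_lt hlt)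
  have htfin : t.Finite := Set.finite_of_encard_eq_coe (k := r + 1 - c + 1) (by rw [ht]; norm_cast)
  obtain ⟨M, hM⟩ := htfin.bddAbove
  obtain ⟨m, hm, g, hg, hgm, hgN⟩ := H (M + 1)
  have hmono : ∀ i j, i ≤ j → j ≤ m → g i ≤ g j := by
    intro i j hij
    induction j, hij using Nat.le_induction with
    | base => exact fun _ => le_rfl
    | succ j _ ih => exact fun h => (ih (by omega)).trans (hg j (by omega))
  have htm : ∀ i ∈ t, i < m := fun i hi => lt_of_lt_of_le (Nat.lt_succ_of_le (hM hi)) hm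
  have hlt' : ∀ i ∈ t, ∀ j ∈ t, i < j → g (i + 1) < g (j + 1) := fun i hi j hj hij =>
    (hmono (i + 1) j hij (htm j hj).le).trans_lt (hgN j (htN hj) (htm j hj)).1
  have hinj : Set.InjOn (fun i => g (i + 1)) t := by
    intro i hi j hj hij
    have hij : g (i + 1) = g (j + 1) := hij
    rcases lt_trichotomy i j with h | h | h
    · have := hlt' i hi j hj h
      omega
    · exact h
    · have := hlt' j hj i hi h
      omega
  have hmaps : Set.MapsTo (fun i => g (i + 1)) t (Finset.Icc c r : Finset ℕ) := by
    intro i hi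
    have h1 := (hgN i (htN hi) (htm i hi)).2
    have h2 := hmono (i + 1) m (htm i hi) le_rfl
    simp only [Finset.coe_Icc, Set.mem_Icc]
    exact ⟨h1, h2.trans hgm⟩
  have := Set.encard_le_encard_of_injOn hmaps hinj
  rw [ht, Set.encard_coe_eq_coe_finsetCard, Nat.card_Icc] at this
  norm_cast at this
  omega

theorem frequently_card_le {A : ℕ → Type*} [∀ n, Finite (A n)] {r : ℕ}
    (hr : alphabetRank A = (r : ℕ∞)) : ∃ᶠ m in atTop, Nat.card (A m) ≤ r := by
  have h : liminf (fun n => ENat.card (A n)) atTop < ((r + 1 : ℕ) : ℕ∞) := by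
    rw [show liminf (fun n => ENat.card (A n)) atTop = r from hr]
    exact_mod_cast Nat.lt_succ_self r
  refine (frequently_lt_of_liminf_lt (by isBoundedDefault) h).mono fun m hm => ?_
  rw [ENat.card_eq_coe_natCard] at hm
  have : Nat.card (A m) < r + 1 := by exact_mod_cast hm
  omega

theorem exists_forall_ge_of_encard_le {P : ℕ → Prop} {k : ℕ}
    (h : {n | ¬ P n}.encard ≤ (k : ℕ∞)) : ∃ M, ∀ n ≥ M, P n := by
  obtain ⟨M, hM⟩ := (Set.finite_of_encard_le_coe h).bddAbove
  refine ⟨M + 1, fun n hn => ?_⟩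
  by_contra hP
  have : n ≤ M := hM hP
  omega

/-- The levels at which a property fails form a set that is bounded in terms of the alphabet rank if
failure forces the ranks of the compositions to increase. -/
theorem encard_le_of_rank {A : ℕ → Type*} [∀ n, Finite (A n)]
    (σ : ∀ n, FreeMonoid (A (n + 1)) →* FreeMonoid (A n))
    {r : ℕ} (hr : alphabetRank A = (r : ℕ∞)) {c : ℕ} {P : ℕ → Prop}
    (h : ∀ i m (h : i + 1 ≤ m), ¬ P i →
      rank (iter σ i m ((Nat.le_succ i).trans h)) ≠ rank (iter σ (i + 1) m h) ∧
      c ≤ rank (iter σ (i + 1) m h)) :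
    {n | ¬ P n}.encard ≤ ((r + 1 - c : ℕ) : ℕ∞) := by
  refine encard_le_of_jumps fun M => ?_
  obtain ⟨m, hm, hcard⟩ := (frequently_atTop.1 (frequently_card_le hr)) M
  refine ⟨m, hm, fun i => if hi : i ≤ m then rank (iter σ i m hi) else 0, ?_, ?_, ?_⟩
  · intro i hi
    simp only [dif_pos hi.le, dif_pos (show i + 1 ≤ m from hi)]
    exact rank_iter_le σ hi
  · simp only [le_refl, dif_pos]
    exact (rank_le_card _).trans hcard
  · intro i hiP hi
    simp only [dif_pos hi.le, dif_pos (show i + 1 ≤ m from hi)]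
    have := h i m hi hiP
    exact ⟨lt_of_le_of_ne (rank_iter_le σ hi) this.1, this.2⟩

end SAdic

theorem mainTheorem1 {A : ℕ → Type*} [∀ n, Finite (A n)]
    (σ : ∀ n, FreeMonoid (A (n + 1)) →* FreeMonoid (A n))
    (r : ℕ) (hr : SAdic.alphabetRank A = (r : ℕ∞)) :
    SAdic.EventuallyRecognizableForAperiodic σ ∧
    SAdic.EventuallyRepresentable σ ∧
    {n : ℕ | ¬ SAdic.RecognizableForAperiodicAt σ n}.encard ≤ ((r - 2 : ℕ) : ℕ∞) ∧
    {n : ℕ | ¬ SAdic.RepresentableAt σ n}.encard ≤ ((r - 1 : ℕ) : ℕ∞) := by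
  -- Harmful jumps end at rank at least 3.
  have h1 := SAdic.encard_le_of_rank σ hr (c := 3) (P := SAdic.RecognizableForAperiodicAt σ)
    fun i m h hP => by
      by_contra! hcon
      refine hP (SAdic.recognizableForAperiodicAt_of_rank σ h ?_)
      by_cases he : SAdic.rank (SAdic.iter σ i m ((Nat.le_succ i).trans h)) =
          SAdic.rank (SAdic.iter σ (i + 1) m h)
      · exact Or.inl he
      · exact Or.inr (by have := hcon he; omega)
  -- Harmful jumps start at rank at least 1, hence end at rank at least 2.
  have h2 := SAdic.encard_le_of_rank σ hr (c := 2) (P := SAdic.RepresentableAt σ)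
    fun i m h hP => by
      have h0 : SAdic.rank (SAdic.iter σ i m ((Nat.le_succ i).trans h)) ≠ 0 := fun h0 =>
        hP (SAdic.representableAt_of_rank_eq_zero σ _ h0)
      have h3 : SAdic.rank (SAdic.iter σ i m ((Nat.le_succ i).trans h)) ≠
          SAdic.rank (SAdic.iter σ (i + 1) m h) := fun h3 =>
        hP (SAdic.representableAt_of_rank σ h h3)
      have h4 : SAdic.rank (SAdic.iter σ i m ((Nat.le_succ i).trans h)) ≤
          SAdic.rank (SAdic.iter σ (i + 1) m h) := SAdic.rank_iter_le σ h
      exact ⟨h3, by omega⟩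
  rw [show r + 1 - 3 = r - 2 by omega] at h1
  rw [show r + 1 - 2 = r - 1 by omega] at h2
  exact ⟨SAdic.exists_forall_ge_of_encard_le h1, SAdic.exists_forall_ge_of_encard_le h2, h1, h2⟩
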